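/- **Setting.** Let $F(\mathbf x)=\mathbb E_{\xi\sim\nu}[f(\mathbf x;\xi)]$ on $\mathbb R^d$, where $f(\cdot;\xi)$ is differentiable and $f(\mathbf x;\cdot)$ is integrable. Assume that $F$ is differentiable and bounded from below, and that $\nabla F$ is $L$-Lipschitz. Fix a starting point $\mathbf x^1\in\mathbb R^d$ and a reference point $\mathbf y\in\mathbb R^d$, both deterministic. Write $\widetilde\nabla=\|\nabla F(\mathbf x^1)\|$. **Method (N-MSGE).** Fix $p\in(1,2]$, $\eta\in[1/2,1)$, $a>0$, and put $\alpha_t=a/(t+1)^{\eta}$ and $B_t=\lceil t^{p/(2(p-1))}\rceil$. For $t\ge1$ draw samples $\xi^t_1,\dots,\xi^t_{B_t+2}$ of law $\nu$ and set $$\mathbf x^{t+1}=\mathbf x^t-\alpha_t\boldsymbol\Psi\Big(\nabla f(\mathbf x^t;\xi^t_1)-\nabla f(\mathbf y;\xi^t_2)+\frac1{B_t}\sum_{j=1}^{B_t}\nabla f(\mathbf y;\xi^t_{j+2})\Big).$$ **Noise.** Let $\mathbf z^t_1=\nabla f(\mathbf x^t;\xi^t_1)-\nabla F(\mathbf x^t)$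 and $\mathbf z^t_j=\nabla f(\mathbf y;\xi^t_j)-\nabla F(\mathbf y)$ for $2\le j\le B_t+2$. For every $t$, the vectors $\mathbf z^t_1,\dots,\mathbf z^t_{B_t+2}$ are independent, identically distributed with a density $P$ that does not depend on $t$, and jointly independent of $(\mathbf x^1,\dots,\mathbf x^t)$. For some $E_0>0$ and all $\|\mathbf x\|\le E_0$, the set $\{\mathbf u: P(\mathbf u)>0,\ P(\mathbf u-\mathbf x)>0\}$ has positive Lebesgue measure. Moreover $\mathbb E[\mathbf z^t_j]=\mathbf 0$ and $\mathbb E\|\mathbf z^t_j\|^p\le\sigma^p$, for some $\sigma>0$. **Nonlinearity.** $\boldsymbol\Psi:\mathbb R^d\to\mathbb R^d$ is of one of two kinds. 1. *Componentwise:* $\boldsymbol\Psi(\mathbf x)=(\psi(x_1),\dots,\psi(x_d))$ with $\psi:\mathbb R\to\mathbb R$ twice continuously differentiable, non-decreasing, odd, strictly increasing on $(-c,c)$ for some $c>0$, with $|\psi|\le C$ and with bounded $\psi'$ and $\psi''$. 2. *Joint:* $\boldsymbol\Psi(\mathbf x)=\mathbf x\,\varphi(\|\mathbf x\|)$ with $\varphi:\mathbb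 R\to\mathbb R$ continuously differentiable, non-increasing and strictly positive on $(0,\infty)$, $s\mapsto s\varphi(s)$ non-decreasing on $(0,\infty)$, $\|\mathbf x\varphi(\|\mathbf x\|)\|\le C$ for all $\mathbf x$, and the operator norm of $\varphi'(\|\mathbf x\|)\frac{\mathbf x\mathbf x^\top}{\|\mathbf x\|}+\varphi(\|\mathbf x\|)I$ bounded uniformly in $\mathbf x$. **Theorem.** Let $\boldsymbol\Phi(\mathbf v)=\mathbb E[\boldsymbol\Psi(\mathbf v+\mathbf z_1-\mathbf z_2)]$ with $\mathbf z_1,\mathbf z_2$ independent of density $P$. There exist $\gamma_1,\gamma_2>0$ such that $$\langle\boldsymbol\Phi(\mathbf v),\mathbf v\rangle\ge\min\{\gamma_1\|\mathbf v\|,\gamma_2\|\mathbf v\|^2\}\quad\text{for all }\mathbf v\in\mathbb R^d.$$ For every such pair $\gamma_1,\gamma_2$: if $$a\le\min\Big\{1,\ \frac{\gamma_2}{1+8C^2},\ \frac{(1-\eta)\gamma_1}{(1+8C^2)(LC+(1-\eta)\widetilde\nabla)}\Big\}$$ (a last entry with zero denominator is read as $+\infty$), then for every integer $t\ge1$ and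 every $\delta\in(0,1)$, with probability at least $1-\delta$, $$\frac1t\sum_{k=1}^t\min\{\|\nabla F(\mathbf x^k)\|,\|\nabla F(\mathbf x^k)\|^2\}\le M\,t^{\eta-1}\Big(\log\tfrac1\delta+\log t+\sum_{k=1}^t(k+1)^{-2\eta}\Big).$$ Here the constant $M$ depends only on $d,\boldsymbol\Psi,C,P,p,\sigma,\gamma_1,\gamma_2,L,\eta,a$ and an upper bound $\Delta$ on $F(\mathbf x^1)-\inf F$; in particular it depends neither on $t$ nor on $\delta$. -/

import Mathlib

open MeasureTheory ProbabilityTheory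
open scoped NNReal ENNReal

noncomputable section

/-- The derivative of the joint map `x ↦ φ(‖x‖) x`, i.e. the operator
`φ'(‖x‖) x xᵀ / ‖x‖ + φ(‖x‖) I`; at `x = 0` the first term is read as zero. -/
def jointDerivative {d : ℕ} (φ : ℝ → ℝ) (x : EuclideanSpace ℝ (Fin d)) :
    EuclideanSpace ℝ (Fin d) →L[ℝ] EuclideanSpace ℝ (Fin d) :=
  (deriv φ ‖x‖ / ‖x‖) • (innerSL ℝ x).smulRight x
    + φ ‖x‖ • ContinuousLinearMap.id ℝ (EuclideanSpace ℝ (Fin d))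

/-- `Ψ` acts componentwise through a smooth bounded scalar map `ψ`, with `|ψ| ≤ C`. -/
def IsSmoothComponentwise {d : ℕ} (C : ℝ)
    (Ψ : EuclideanSpace ℝ (Fin d) → EuclideanSpace ℝ (Fin d)) : Prop :=
  ∃ ψ : ℝ → ℝ, (∀ x i, Ψ x i = ψ (x i)) ∧
    ContDiff ℝ 2 ψ ∧ Monotone ψ ∧ (∀ s, ψ (-s) = -ψ s) ∧
    (∃ c : ℝ, 0 < c ∧ StrictMonoOn ψ (Set.Ioo (-c) c)) ∧
    (∀ s, |ψ s| ≤ C) ∧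
    (∃ K₁ : ℝ, ∀ s, |deriv ψ s| ≤ K₁) ∧
    (∃ K₂ : ℝ, ∀ s, |deriv (deriv ψ) s| ≤ K₂)

/-- `Ψ` is a smooth bounded joint map `Ψ x = φ(‖x‖) x`, with `‖Ψ‖ ≤ C`. -/
def IsSmoothJoint {d : ℕ} (C : ℝ)
    (Ψ : EuclideanSpace ℝ (Fin d) → EuclideanSpace ℝ (Fin d)) : Prop :=
  ∃ φ : ℝ → ℝ, (∀ x, Ψ x = φ ‖x‖ • x) ∧
    ContDiff ℝ 1 φ ∧ MonotoneOn (fun s => s * φ s) (Set.Ioi 0) ∧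
    AntitoneOn φ (Set.Ioi 0) ∧ (∀ s, 0 < s → 0 < φ s) ∧
    (∀ x : EuclideanSpace ℝ (Fin d), ‖φ ‖x‖ • x‖ ≤ C) ∧
    (∃ K₃ : ℝ, ∀ x : EuclideanSpace ℝ (Fin d), ‖jointDerivative φ x‖ ≤ K₃)

/-- The smooth bounded nonlinearities: componentwise or joint, with bound `C`. -/
def IsSmoothNonlinearity {d : ℕ} (C : ℝ)
    (Ψ : EuclideanSpace ℝ (Fin d) → EuclideanSpace ℝ (Fin d)) : Prop :=
  IsSmoothComponentwise C Ψ ∨ IsSmoothJoint C Ψ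

/-- The law on `ℝ^d` with Lebesgue density `P`. -/
def noiseLaw {d : ℕ} (P : EuclideanSpace ℝ (Fin d) → ℝ) :
    Measure (EuclideanSpace ℝ (Fin d)) :=
  volume.withDensity (fun z => ENNReal.ofReal (P z))

/-- `P` is a probability density whose overlaps with its small translates have positive
Lebesgue measure, with mean zero and `p`-th absolute moment at most `σ ^ p`. -/
structure IsNoiseDensity {d : ℕ} (p σ : ℝ) (P : EuclideanSpace ℝ (Fin d) → ℝ) : Prop where
  measurable : Measurable P
  nonneg : ∀ z, 0 ≤ P z
  total : ∫⁻ z, ENNReal.ofReal (P z) = 1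
  overlap : ∃ E₀ : ℝ, 0 < E₀ ∧ ∀ x : EuclideanSpace ℝ (Fin d), ‖x‖ ≤ E₀ →
    0 < volume {y : EuclideanSpace ℝ (Fin d) | 0 < P y ∧ 0 < P (y - x)}
  moment : ∫⁻ z, ENNReal.ofReal (‖z‖ ^ p) ∂(noiseLaw P) ≤ ENNReal.ofReal (σ ^ p)
  mean : ∫ z, z ∂(noiseLaw P) = 0

/-- The denoised nonlinearity `Φ(v) = E[Ψ(v + z₁ - z₂)]`, with `z₁, z₂` independent of
density `P`. -/
def denoised {d : ℕ} (Ψ : EuclideanSpace ℝ (Fin d) → EuclideanSpace ℝ (Fin d))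
    (P : EuclideanSpace ℝ (Fin d) → ℝ) (v : EuclideanSpace ℝ (Fin d)) :
    EuclideanSpace ℝ (Fin d) :=
  ∫ z, Ψ (v + (z.1 - z.2)) ∂((noiseLaw P).prod (noiseLaw P))

/-- `γ₁, γ₂ > 0` and `⟨Φ(v), v⟩ ≥ min {γ₁ ‖v‖, γ₂ ‖v‖²}` for every `v`. -/
def AreAlignmentConstants {d : ℕ}
    (Ψ : EuclideanSpace ℝ (Fin d) → EuclideanSpace ℝ (Fin d))
    (P : EuclideanSpace ℝ (Fin d) → ℝ) (γ₁ γ₂ : ℝ) : Prop :=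
  0 < γ₁ ∧ 0 < γ₂ ∧ ∀ v : EuclideanSpace ℝ (Fin d),
    min (γ₁ * ‖v‖) (γ₂ * ‖v‖ ^ 2) ≤ inner ℝ (denoised Ψ P v) v

/-- The population cost `F(x) = E[f(x; ξ)]`, `ξ` of law `ν`. -/
def populationCost {d : ℕ} {Ξ : Type*} [MeasurableSpace Ξ] (ν : Measure Ξ)
    (f : EuclideanSpace ℝ (Fin d) → Ξ → ℝ) (x : EuclideanSpace ℝ (Fin d)) : ℝ :=
  ∫ s, f x s ∂ν

/-- The batch size `B_t = t ^ (p / (2 (p - 1)))`, rounded up to an integer. -/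
def batchSize (p : ℝ) (t : ℕ) : ℕ := ⌈(t : ℝ) ^ (p / (2 * (p - 1)))⌉₊

/-- The step size `α_t = a / (t + 1) ^ η`. -/
def stepSize (a η : ℝ) (t : ℕ) : ℝ := a / ((t : ℝ) + 1) ^ η

/-- The stochastic gradient `∇f(x; s)` (in the variable `x`). -/
def stochGrad {d : ℕ} {Ξ : Type*} (f : EuclideanSpace ℝ (Fin d) → Ξ → ℝ)
    (x : EuclideanSpace ℝ (Fin d)) (s : Ξ) : EuclideanSpace ℝ (Fin d) :=
  gradient (fun u => f u s) x

/-- The mini-batch symmetrized gradient estimator at the point `x`, with reference point `y`,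
batch size `B` and samples `s 1, …, s (B + 2)`. -/
def msge {d : ℕ} {Ξ : Type*} (f : EuclideanSpace ℝ (Fin d) → Ξ → ℝ)
    (y : EuclideanSpace ℝ (Fin d)) (B : ℕ) (x : EuclideanSpace ℝ (Fin d)) (s : ℕ → Ξ) :
    EuclideanSpace ℝ (Fin d) :=
  stochGrad f x (s 1) - stochGrad f y (s 2)
    + (1 / (B : ℝ)) • ∑ j ∈ Finset.Icc 1 B, stochGrad f y (s (j + 2))

/-- `x 1, x 2, …` are the iterates of N-MSGE started at `x₁`, where `ξ t j` is the `j`-th sample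
drawn in iteration `t` (the value `x 0` is not used). -/
def IsNMSGE {d : ℕ} {Ω Ξ : Type*} (Ψ : EuclideanSpace ℝ (Fin d) → EuclideanSpace ℝ (Fin d))
    (f : EuclideanSpace ℝ (Fin d) → Ξ → ℝ) (a η p : ℝ) (x₁ y : EuclideanSpace ℝ (Fin d))
    (ξ : ℕ → ℕ → Ω → Ξ) (x : ℕ → Ω → EuclideanSpace ℝ (Fin d)) : Prop :=
  (∀ ω, x 1 ω = x₁) ∧ ∀ t, 1 ≤ t → ∀ ω,
    x (t + 1) ω
      = x t ω - stepSize a η t • Ψ (msge f y (batchSize p t) (x t ω) (fun j => ξ t j ω))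

/-- The gradient noise in iteration `t`: the first sample is used at the current iterate, every
other one at the reference point `y`. -/
def gradNoise {d : ℕ} {Ω Ξ : Type*} [MeasurableSpace Ξ] (ν : Measure Ξ)
    (f : EuclideanSpace ℝ (Fin d) → Ξ → ℝ) (y : EuclideanSpace ℝ (Fin d))
    (ξ : ℕ → ℕ → Ω → Ξ) (x : ℕ → Ω → EuclideanSpace ℝ (Fin d)) (t j : ℕ) (ω : Ω) :
    EuclideanSpace ℝ (Fin d) :=
  if j = 1 then stochGrad f (x t ω) (ξ t 1 ω) - gradient (populationCost ν f) (x t ω)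
  else stochGrad f y (ξ t j ω) - gradient (populationCost ν f) y

/-- In each iteration `t`, the noise vectors `z t 1, …, z t (B t + 2)` are independent, each with
density `P`, and jointly independent of the history `x 1, …, x t`. -/
def IsIIDNoise {d : ℕ} {Ω : Type*} [MeasurableSpace Ω] (μ : Measure Ω)
    (P : EuclideanSpace ℝ (Fin d) → ℝ) (B : ℕ → ℕ)
    (x : ℕ → Ω → EuclideanSpace ℝ (Fin d)) (z : ℕ → ℕ → Ω → EuclideanSpace ℝ (Fin d)) : Prop :=
  ∀ t, 1 ≤ t →
    (∀ j ∈ Finset.Icc 1 (B t + 2), HasLaw (z t j) (noiseLaw P) μ) ∧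
    iIndepFun (fun (j : Finset.Icc 1 (B t + 2)) => z t j) μ ∧
    IndepFun (fun ω (k : Finset.Icc 1 t) => x k ω)
      (fun ω (j : Finset.Icc 1 (B t + 2)) => z t j ω) μ

end

/-! Alignment. Put `z = z₁ - z₂`. Since `z` is symmetric and `Ψ` is odd, `2⟨Φ(v), v⟩ = E⟨Ψ(z + v) -
Ψ(z - v), v⟩`, and monotonicity of `Ψ` makes the integrand nonnegative. The overlap condition on `P`
forces `z` to charge every ball centred near the origin; a ball on which `Ψ` is strongly monotone
gives quadratic growth for small `v`, and monotonicity along rays turns this into linear growth for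
large `v` (`IsMonotoneClipping.exists_alignmentConstants`).

Drift. In the estimator the gradients at `y` cancel, leaving `∇F(x^t) + z₁ - z₂ + S` with `S` the
mean of `B_t` noises. Truncation gives `E‖S‖ = O(t^(-1/2))` for the chosen batch size
(`integral_norm_batch_mean_le`). As `Ψ` is Lipschitz, the expected decrease of `F` is that of `Φ` up
to `O(α_t ‖∇F‖ t^(-1/2))`; Young's inequality trades this for a quarter of the drift plus `c / t`,
and the harmonic sum is the source of `log t`.

Concentration. The gradient grows at most like `√t` along the iterates while `α_t` decays at least
like `t^(-1/2)`, so `α_t ‖∇F(x^t)‖ ≤ G` surely (`step_norm_gradient_le`). Hence one small `lam`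
serves all times: by `e^X ≤ 1 + X + X²` the fluctuation of a step costs another quarter of the
drift. The exponential of `lam` times (cost + half the accumulated drift - errors) then has
expectation at most one (`lintegral_exp_compensated_cost_le_one`), and Markov's inequality produces
`log (1 / δ)`. Dividing by the lower bound `a / 2 * t ^ (-η)` on the steps gives the rate `t ^ (η -
1)`. -/

/-- Bounded, Lipschitz, odd, monotone maps that are strongly monotone near points arbitrarily
close to the origin. -/
structure IsMonotoneClipping {E : Type*} [NormedAddCommGroup E] [InnerProductSpace ℝ E]
    (R : ℝ) (K : ℝ≥0) (Ψ : E → E) : Prop where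
  bound : ∀ x, ‖Ψ x‖ ≤ R
  lipschitz : LipschitzWith K Ψ
  odd : ∀ x, Ψ (-x) = -Ψ x
  monotone : ∀ x y, 0 ≤ inner ℝ (Ψ x - Ψ y) (x - y)
  strong : ∀ ε : ℝ, 0 < ε → ∃ (u : E) (r κ : ℝ), ‖u‖ < ε ∧ 0 < r ∧ 0 < κ ∧
    ∀ w v, ‖w - u‖ < r → ‖v‖ < r → κ * ‖v‖ ^ 2 ≤ inner ℝ (Ψ (w + v) - Ψ (w - v)) v

/-! ### Joint nonlinearities: monotonicity and Lipschitz bounds for radial maps -/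

section Joint

variable {E : Type*} [NormedAddCommGroup E] [InnerProductSpace ℝ E]

/-- Splits into a radial part, governed by `s * φ s`, and an angular part that is nonnegative by
Cauchy–Schwarz when `A + B ≥ 0`. With its companion for the squared norm it replaces differentiating
the radial map, which is awkward at the origin. -/
theorem inner_radial_sub_radial (A B : ℝ) (x y : E) :
    inner ℝ (A • x - B • y) (x - y)
      = (‖x‖ * A - ‖y‖ * B) * (‖x‖ - ‖y‖) + (A + B) * (‖x‖ * ‖y‖ - inner ℝ x y) := by
  simp only [inner_sub_left, inner_sub_right, real_inner_smul_left,
    real_inner_self_eq_norm_sq, real_inner_comm x y]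
  ring

theorem norm_radial_sub_radial_sq (A B : ℝ) (x y : E) :
    ‖A • x - B • y‖ ^ 2
      = (‖x‖ * A - ‖y‖ * B) ^ 2 + 2 * (A * B) * (‖x‖ * ‖y‖ - inner ℝ x y) := by
  rw [norm_sub_sq_real, norm_smul, norm_smul, real_inner_smul_left, real_inner_smul_right,
    mul_pow, mul_pow, Real.norm_eq_abs, Real.norm_eq_abs, sq_abs, sq_abs]
  ring

theorem norm_radial_sub_radial_le {A B K : ℝ} {x y : E} (hA : 0 ≤ A) (hAB : A ≤ B) (hB : B ≤ K)
    (hs : ‖y‖ ≤ ‖x‖) (h : ‖y‖ * B ≤ ‖x‖ * A) : ‖A • x - B • y‖ ≤ K * ‖x - y‖ := by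
  have hK : 0 ≤ K := hA.trans (hAB.trans hB)
  refine (sq_le_sq₀ (norm_nonneg _) (by positivity)).1 ?_
  have h1 := norm_radial_sub_radial_sq A B x y
  have h2 := norm_radial_sub_radial_sq 1 1 x y
  simp only [one_smul, mul_one] at h2
  rw [mul_pow, h1, h2]
  have hi : 0 ≤ ‖x‖ * ‖y‖ - inner ℝ x y := sub_nonneg.2 (real_inner_le_norm x y)
  have hABK : A * B ≤ K ^ 2 := by nlinarith
  -- Replace `A` by the larger `B`, then `B` by `K`.
  have hd : ‖x‖ * A - ‖y‖ * B ≤ K * (‖x‖ - ‖y‖) := by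
    nlinarith [norm_nonneg x, mul_le_mul_of_nonneg_left hAB (norm_nonneg x),
      mul_le_mul_of_nonneg_right hB (sub_nonneg.2 hs)]
  have hd2 : (‖x‖ * A - ‖y‖ * B) ^ 2 ≤ (K * (‖x‖ - ‖y‖)) ^ 2 :=
    pow_le_pow_left₀ (sub_nonneg.2 h) hd 2
  nlinarith [mul_le_mul_of_nonneg_right hABK hi]

/-- The derivative of `s * φ s` at zero is `φ 0 > 0`, so by continuity it stays above half of this
nearby. -/
theorem exists_strictly_increasing_radius {φ : ℝ → ℝ} (hφ : ContDiff ℝ 1 φ) (h0 : 0 < φ 0) :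
    ∃ r : ℝ, 0 < r ∧ ∀ s t, 0 ≤ t → t ≤ s → s ≤ r →
      φ 0 / 2 * (s - t) ≤ s * φ s - t * φ t ∧ φ 0 / 2 ≤ φ s := by
  have hg : ContDiff ℝ 1 (fun s => s * φ s) := contDiff_id.mul hφ
  have hc : Continuous (deriv (fun s => s * φ s)) := hg.continuous_deriv le_rfl
  have hd0 : deriv (fun s => s * φ s) 0 = φ 0 := by
    have := (hasDerivAt_id (0 : ℝ)).mul ((hφ.differentiable one_ne_zero) 0).hasDerivAt
    simpa [Pi.mul_def] using this.deriv
  have e1 : ∀ᶠ s in nhds (0 : ℝ), φ 0 / 2 < deriv (fun s => s * φ s) s :=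
    hc.continuousAt.eventually_const_lt (by rw [hd0]; linarith)
  have e2 : ∀ᶠ s in nhds (0 : ℝ), φ 0 / 2 < φ s :=
    hφ.continuous.continuousAt.eventually_const_lt (by linarith)
  obtain ⟨ε, hε, hb⟩ := Metric.eventually_nhds_iff.1 (e1.and e2)
  have hmem : ∀ s ∈ Set.Icc (0 : ℝ) (ε / 2), dist s 0 < ε := by
    intro s hs
    rw [Real.dist_eq, sub_zero, abs_of_nonneg hs.1]
    linarith [hs.2]
  refine ⟨ε / 2, by positivity, fun s t ht hts hs => ⟨?_, (hb (hmem s ⟨ht.trans hts, hs⟩)).2.le⟩⟩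
  refine (convex_Icc (0 : ℝ) (ε / 2)).mul_sub_le_image_sub_of_le_deriv hg.continuous.continuousOn
    (hg.differentiable one_ne_zero).differentiableOn ?_ t ⟨ht, hts.trans hs⟩ s ⟨ht.trans hts, hs⟩ hts
  intro x hx
  exact (hb (hmem x (interior_subset hx))).1.le

theorem isMonotoneClipping_radial {R : ℝ} {φ : ℝ → ℝ} (hφ : ContDiff ℝ 1 φ)
    (hmono : MonotoneOn (fun s => s * φ s) (Set.Ioi 0)) (hanti : AntitoneOn φ (Set.Ioi 0))
    (hpos : ∀ s, 0 < s → 0 < φ s) (hR : ∀ x : E, ‖φ ‖x‖ • x‖ ≤ R) :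
    IsMonotoneClipping R (φ 0).toNNReal (fun x : E => φ ‖x‖ • x) := by
  -- Continuity carries both monotonicity properties to the closed half-line; this yields `φ 0 ≥ φ 1
  -- > 0` and makes `φ 0` the maximum of `φ` there, hence the Lipschitz constant.
  have hanti' : AntitoneOn φ (Set.Ici 0) := by
    have hc : ClusterPt (0 : ℝ) (Filter.principal (Set.Ioi 0)) := by
      rw [← mem_closure_iff_clusterPt, closure_Ioi]; exact Set.mem_Ici.2 le_rfl
    rw [← Set.Ioi_insert]
    simpa using
      (hanti.neg.insert_of_continuousWithinAt hc hφ.continuous.neg.continuousWithinAt).neg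
  have hmono' : MonotoneOn (fun s => s * φ s) (Set.Ici 0) := by
    have hc : ClusterPt (0 : ℝ) (Filter.principal (Set.Ioi 0)) := by
      rw [← mem_closure_iff_clusterPt, closure_Ioi]; exact Set.mem_Ici.2 le_rfl
    rw [← Set.Ioi_insert]
    exact hmono.insert_of_continuousWithinAt hc
      (continuous_id.mul hφ.continuous).continuousWithinAt
  have h0 : 0 < φ 0 :=
    (hpos 1 one_pos).trans_le
      (hanti' (Set.mem_Ici.2 le_rfl) (Set.mem_Ici.2 zero_le_one) zero_le_one)
  have hnn : ∀ s, 0 ≤ s → 0 ≤ φ s := fun s hs => by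
    rcases hs.eq_or_lt with h | h
    · rw [← h]; exact h0.le
    · exact (hpos s h).le
  have hle0 : ∀ s, 0 ≤ s → φ s ≤ φ 0 := fun s hs => hanti' (Set.mem_Ici.2 le_rfl) hs hs
  refine ⟨hR, ?_, fun x => by simp, ?_, ?_⟩
  · refine LipschitzWith.of_dist_le_mul fun x y => ?_
    rw [dist_eq_norm, dist_eq_norm, Real.coe_toNNReal _ h0.le]
    rcases le_total ‖y‖ ‖x‖ with h | h
    · exact norm_radial_sub_radial_le (hnn _ (norm_nonneg x))
        (hanti' (norm_nonneg y) (norm_nonneg x) h)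
        (hle0 _ (norm_nonneg y)) h (hmono' (norm_nonneg y) (norm_nonneg x) h)
    · rw [norm_sub_rev, norm_sub_rev x]
      exact norm_radial_sub_radial_le (hnn _ (norm_nonneg y))
        (hanti' (norm_nonneg x) (norm_nonneg y) h)
        (hle0 _ (norm_nonneg x)) h (hmono' (norm_nonneg x) (norm_nonneg y) h)
  · intro x y
    rw [inner_radial_sub_radial]
    have hi : 0 ≤ ‖x‖ * ‖y‖ - inner ℝ x y := sub_nonneg.2 (real_inner_le_norm x y)
    have hs : 0 ≤ φ ‖x‖ + φ ‖y‖ := add_nonneg (hnn _ (norm_nonneg x)) (hnn _ (norm_nonneg y))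
    refine add_nonneg ?_ (mul_nonneg hs hi)
    rcases le_total ‖y‖ ‖x‖ with h | h
    · exact mul_nonneg (sub_nonneg.2 (hmono' (norm_nonneg y) (norm_nonneg x) h))
        (sub_nonneg.2 h)
    · exact mul_nonneg_of_nonpos_of_nonpos
        (sub_nonpos.2 (hmono' (norm_nonneg x) (norm_nonneg y) h)) (sub_nonpos.2 h)
  · intro ε hε
    obtain ⟨r, hr, hstr⟩ := exists_strictly_increasing_radius hφ h0
    -- Radius `r / 2` keeps `w ± v` in the ball of radius `r`. Strong monotonicity with constant `φ
    -- 0 / 2`, applied to the difference `2v`, gives `κ = φ 0`.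
    refine ⟨0, r / 2, φ 0, by simpa using hε, by positivity, h0, fun w v hw hv => ?_⟩
    rw [sub_zero] at hw
    have key : ∀ x y : E, ‖x‖ ≤ r → ‖y‖ ≤ r →
        φ 0 / 2 * ‖x - y‖ ^ 2 ≤ inner ℝ (φ ‖x‖ • x - φ ‖y‖ • y) (x - y) := by
      intro x y hx hy
      rw [inner_radial_sub_radial]
      have h2 := norm_radial_sub_radial_sq 1 1 x y
      simp only [one_smul, mul_one] at h2
      rw [h2]
      have hi : 0 ≤ ‖x‖ * ‖y‖ - inner ℝ x y := sub_nonneg.2 (real_inner_le_norm x y)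
      have hx' := (hstr ‖x‖ ‖x‖ (norm_nonneg x) le_rfl hx).2
      have hy' := (hstr ‖y‖ ‖y‖ (norm_nonneg y) le_rfl hy).2
      have hs : φ 0 * (‖x‖ * ‖y‖ - inner ℝ x y)
          ≤ (φ ‖x‖ + φ ‖y‖) * (‖x‖ * ‖y‖ - inner ℝ x y) :=
        mul_le_mul_of_nonneg_right (by linarith) hi
      have hq : φ 0 / 2 * (‖x‖ - ‖y‖) ^ 2
          ≤ (‖x‖ * φ ‖x‖ - ‖y‖ * φ ‖y‖) * (‖x‖ - ‖y‖) := by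
        rcases le_total ‖y‖ ‖x‖ with h | h
        · have := mul_le_mul_of_nonneg_right (hstr ‖x‖ ‖y‖ (norm_nonneg y) h hx).1
            (sub_nonneg.2 h)
          linarith
        · have := mul_le_mul_of_nonneg_right (hstr ‖y‖ ‖x‖ (norm_nonneg x) h hy).1
            (sub_nonneg.2 h)
          linarith
      linarith
    have h := key (w + v) (w - v) ((norm_add_le w v).trans (by linarith))
      ((norm_sub_le w v).trans (by linarith))
    have h2 : (w + v) - (w - v) = (2 : ℝ) • v := by rw [two_smul]; abel
    rw [h2, norm_smul, inner_smul_right] at h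
    simp only [Real.norm_ofNat] at h
    linarith

end Joint

/-! ### Componentwise nonlinearities -/

theorem isMonotoneClipping_componentwise {d : ℕ} {C K₁ : ℝ} {ψ : ℝ → ℝ}
    {Ψ : EuclideanSpace ℝ (Fin d) → EuclideanSpace ℝ (Fin d)} (hΨ : ∀ x i, Ψ x i = ψ (x i))
    (hψ : ContDiff ℝ 2 ψ) (hmono : Monotone ψ) (hodd : ∀ s, ψ (-s) = -ψ s)
    {c : ℝ} (hc : 0 < c) (hstr : StrictMonoOn ψ (Set.Ioo (-c) c)) (hC : ∀ s, |ψ s| ≤ C)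
    (hK : ∀ s, |deriv ψ s| ≤ K₁) :
    IsMonotoneClipping (√d * C) K₁.toNNReal Ψ := by
  have hC0 : 0 ≤ C := (abs_nonneg _).trans (hC 0)
  have hK0 : 0 ≤ K₁ := (abs_nonneg _).trans (hK 0)
  have hdiff : Differentiable ℝ ψ := hψ.differentiable two_ne_zero
  have hlip : LipschitzWith K₁.toNNReal ψ := lipschitzWith_of_nnnorm_deriv_le hdiff fun s => by
    rw [← NNReal.coe_le_coe, coe_nnnorm, Real.norm_eq_abs, Real.coe_toNNReal _ hK0]
    exact hK s
  refine ⟨fun x => ?_, ?_, fun x => ?_, fun x y => ?_, fun ε hε => ?_⟩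
  · refine (sq_le_sq₀ (norm_nonneg _) (by positivity)).1 ?_
    rw [EuclideanSpace.real_norm_sq_eq, mul_pow, Real.sq_sqrt (Nat.cast_nonneg d)]
    calc ∑ i, (Ψ x i) ^ 2 ≤ ∑ _i : Fin d, C ^ 2 := Finset.sum_le_sum fun i _ => by
          rw [hΨ]; exact sq_le_sq' (abs_le.1 (hC _)).1 (abs_le.1 (hC _)).2
      _ = d * C ^ 2 := by simp
  · refine LipschitzWith.of_dist_le_mul fun x y => ?_
    rw [dist_eq_norm, dist_eq_norm]
    refine (sq_le_sq₀ (norm_nonneg _) (by positivity)).1 ?_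
    rw [mul_pow, EuclideanSpace.real_norm_sq_eq, EuclideanSpace.real_norm_sq_eq, Finset.mul_sum]
    refine Finset.sum_le_sum fun i _ => ?_
    have h := hlip.dist_le_mul (x i) (y i)
    rw [Real.dist_eq, Real.dist_eq] at h
    rw [PiLp.sub_apply, PiLp.sub_apply, hΨ, hΨ, ← sq_abs, ← sq_abs (x i - y i), ← mul_pow]
    exact pow_le_pow_left₀ (abs_nonneg _) h 2
  · ext i
    rw [hΨ, PiLp.neg_apply, PiLp.neg_apply, hΨ, hodd]
  · rw [PiLp.inner_apply]
    refine Finset.sum_nonneg fun i _ => ?_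
    simp only [PiLp.sub_apply, hΨ, RCLike.inner_apply, conj_trivial]
    rcases le_total (y i) (x i) with h | h
    · exact mul_nonneg (sub_nonneg.2 h) (sub_nonneg.2 (hmono h))
    · exact mul_nonneg_of_nonpos_of_nonpos (sub_nonpos.2 h) (sub_nonpos.2 (hmono h))
  · have hd1 : 0 < √d + 1 := by positivity
    -- Strict monotonicity allows `ψ'(0) = 0`, so the centre cannot be the origin. The mean value
    -- theorem on `[0, b]` supplies `u` with `ψ'(u) > 0`, and `b` is small enough for `(u, …, u)` to
    -- have norm below `ε`.
    set b := min (c / 2) (ε / (√d + 1)) with hb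
    have hb0 : 0 < b := lt_min (by positivity) (by positivity)
    have hbc : b ≤ c / 2 := min_le_left _ _
    have hbε : b * (√d + 1) ≤ ε := by
      rw [← le_div_iff₀ hd1]; exact min_le_right _ _
    obtain ⟨u, hu, hu'⟩ := exists_deriv_eq_slope ψ hb0 hdiff.continuous.continuousOn
      hdiff.differentiableOn
    have hupos : 0 < deriv ψ u := by
      rw [hu']
      refine div_pos (sub_pos.2 (hstr ?_ ?_ hb0)) (by linarith)
      · exact ⟨by linarith, hc⟩
      · exact ⟨by linarith, by linarith⟩
    have hcont : Continuous (deriv ψ) := hψ.continuous_deriv one_le_two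
    obtain ⟨ρ, hρ, hball⟩ := Metric.eventually_nhds_iff.1
      (hcont.continuousAt.eventually_const_lt (half_lt_self hupos))
    refine ⟨WithLp.toLp 2 fun _ => u, ρ / 2, deriv ψ u, ?_, by positivity, hupos,
      fun w v hw hv => ?_⟩
    · have hn : ‖(WithLp.toLp 2 fun _ => u : EuclideanSpace ℝ (Fin d))‖ = √d * u := by
        rw [EuclideanSpace.norm_eq]
        simp only [Real.norm_eq_abs, sq_abs, Finset.sum_const, Finset.card_univ,
          Fintype.card_fin, nsmul_eq_mul]
        rw [Real.sqrt_mul (Nat.cast_nonneg d), Real.sqrt_sq hu.1.le]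
      rw [hn]
      nlinarith [hu.1, hu.2, mul_le_mul_of_nonneg_left hu.2.le (Real.sqrt_nonneg d)]
    · rw [EuclideanSpace.real_norm_sq_eq, Finset.mul_sum, PiLp.inner_apply]
      refine Finset.sum_le_sum fun i _ => ?_
      simp only [PiLp.sub_apply, PiLp.add_apply, hΨ, RCLike.inner_apply, conj_trivial]
      have hwi : |w i - u| < ρ / 2 := by
        refine lt_of_le_of_lt ?_ hw
        exact PiLp.norm_apply_le (w - (WithLp.toLp 2 fun _ => u)) i
      have hvi : |v i| < ρ / 2 := lt_of_le_of_lt (PiLp.norm_apply_le v i) hv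
      have hinc : ∀ s ∈ Metric.ball u ρ, ∀ t ∈ Metric.ball u ρ, s ≤ t →
          deriv ψ u / 2 * (t - s) ≤ ψ t - ψ s :=
        (convex_ball u ρ).mul_sub_le_image_sub_of_le_deriv hdiff.continuous.continuousOn
          hdiff.differentiableOn fun x hx => by
            have hx' : x ∈ Metric.ball u ρ := interior_subset hx
            exact (hball hx').le
      have hm1 : w i + v i ∈ Metric.ball u ρ := by
        rw [Metric.mem_ball, Real.dist_eq]
        calc |w i + v i - u| = |(w i - u) + v i| := by ring_nf
          _ ≤ |w i - u| + |v i| := abs_add_le _ _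
          _ < ρ := by linarith
      have hm2 : w i - v i ∈ Metric.ball u ρ := by
        rw [Metric.mem_ball, Real.dist_eq]
        calc |w i - v i - u| = |(w i - u) - v i| := by ring_nf
          _ ≤ |w i - u| + |v i| := abs_sub _ _
          _ < ρ := by linarith
      rcases le_total 0 (v i) with h | h
      · have := mul_le_mul_of_nonneg_left (hinc _ hm2 _ hm1 (by linarith)) h
        linarith
      · have := mul_le_mul_of_nonneg_left (hinc _ hm1 _ hm2 (by linarith)) (neg_nonneg.2 h)
        linarith

theorem IsSmoothNonlinearity.isMonotoneClipping {d : ℕ} {C : ℝ}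
    {Ψ : EuclideanSpace ℝ (Fin d) → EuclideanSpace ℝ (Fin d)} (h : IsSmoothNonlinearity C Ψ) :
    ∃ (R : ℝ) (K : ℝ≥0), IsMonotoneClipping R K Ψ := by
  rcases h with ⟨ψ, h1, h2, h3, h4, ⟨c, hc, h5⟩, h6, ⟨K₁, h7⟩, -⟩ | ⟨φ, h1, h2, h3, h4, h5, h6, -⟩
  · exact ⟨_, _, isMonotoneClipping_componentwise h1 h2 h3 h4 hc h5 h6 h7⟩
  · obtain rfl : Ψ = fun x => φ ‖x‖ • x := funext h1
    exact ⟨_, _, isMonotoneClipping_radial h2 h3 h4 h5 h6⟩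

/-! ### Alignment of the denoised nonlinearity -/

section Alignment

variable {d : ℕ} {p σ : ℝ} {P : EuclideanSpace ℝ (Fin d) → ℝ}

theorem IsNoiseDensity.isProbabilityMeasure (hP : IsNoiseDensity p σ P) :
    IsProbabilityMeasure (noiseLaw P) :=
  ⟨by rw [noiseLaw, withDensity_apply _ MeasurableSet.univ, Measure.restrict_univ, hP.total]⟩

/-- The difference of two independent noise vectors charges every small ball near the origin. -/
theorem IsNoiseDensity.exists_difference_charges_ball (hP : IsNoiseDensity p σ P) :
    ∃ ε : ℝ, 0 < ε ∧ ∀ (u : EuclideanSpace ℝ (Fin d)) (r : ℝ), ‖u‖ < ε → 0 < r →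
      0 < ((noiseLaw P).prod (noiseLaw P)) {z | ‖(z.1 - z.2) - u‖ < r} := by
  obtain ⟨E₀, hE₀, hov⟩ := hP.overlap
  refine ⟨E₀, hE₀, fun u r hu hr => pos_iff_ne_zero.2 fun h0 => ?_⟩
  have hm : Measurable fun z => ENNReal.ofReal (P z) := hP.measurable.ennreal_ofReal
  have hm2 : Measurable fun z : EuclideanSpace ℝ (Fin d) × EuclideanSpace ℝ (Fin d) =>
      ENNReal.ofReal (P z.1) * ENNReal.ofReal (P z.2) :=
    (hm.comp measurable_fst).mul (hm.comp measurable_snd)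
  rw [noiseLaw, prod_withDensity hm hm, withDensity_apply_eq_zero' hm2.aemeasurable] at h0
  have hae : ∀ᵐ z ∂(volume.prod volume : Measure (EuclideanSpace ℝ (Fin d) ×
      EuclideanSpace ℝ (Fin d))), ¬ (0 < P z.1 ∧ 0 < P z.2 ∧ ‖(z.1 - z.2) - u‖ < r) := by
    rw [ae_iff]
    refine measure_mono_null (fun z hz => ?_) h0
    simp only [not_not, Set.mem_ofPred_eq] at hz
    refine ⟨?_, hz.2.2⟩
    simp only [Set.mem_ofPred_eq, ne_eq, mul_eq_zero, ENNReal.ofReal_eq_zero, not_or, not_le]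
    exact ⟨hz.1, hz.2.1⟩
  -- The shear `(x, y) ↦ (x + y, y)` preserves Lebesgue measure and makes the difference a
  -- coordinate: for almost every `x`, almost every `y` avoids the bad event.
  have hae2 := Measure.ae_ae_of_ae_prod
    ((measurePreserving_add_prod (volume : Measure (EuclideanSpace ℝ (Fin d)))
      (volume : Measure (EuclideanSpace ℝ (Fin d)))).quasiMeasurePreserving.ae hae)
  -- The radius keeps `x` within `r` of `u` and within `E₀` of the origin, so the overlap condition
  -- at `-x` contradicts nullity.
  have hball : volume (Metric.ball u (min r (E₀ - ‖u‖))) ≠ 0 :=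
    (Metric.isOpen_ball.measure_pos volume
      ⟨u, Metric.mem_ball_self (lt_min hr (by linarith))⟩).ne'
  obtain ⟨x, hx, hxae⟩ : ∃ x ∈ Metric.ball u (min r (E₀ - ‖u‖)),
      ∀ᵐ y, ¬ (0 < P (x + y) ∧ 0 < P y ∧ ‖((x + y) - y) - u‖ < r) := by
    by_contra hne
    push Not at hne
    exact hball (measure_mono_null (fun x hx => by
      simpa using hne x hx) hae2)
  rw [Metric.mem_ball, dist_eq_norm] at hx
  have hx1 : ‖x - u‖ < r := hx.trans_le (min_le_left _ _)
  have hx2 : ‖-x‖ ≤ E₀ := by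
    have h1 : ‖x - u‖ < E₀ - ‖u‖ := hx.trans_le (min_le_right _ _)
    have h2 : ‖x‖ ≤ ‖x - u‖ + ‖u‖ := by simpa using norm_add_le (x - u) u
    rw [norm_neg]; linarith
  refine (hov (-x) hx2).ne' (measure_mono_null (fun y hy => ?_) (ae_iff.1 hxae))
  simp only [sub_neg_eq_add, Set.mem_ofPred_eq] at hy
  simp only [not_not, Set.mem_ofPred_eq, add_sub_cancel_right]
  exact ⟨by rw [add_comm]; exact hy.2, hy.1, hx1⟩

variable {R : ℝ} {K : ℝ≥0} {Ψ : EuclideanSpace ℝ (Fin d) → EuclideanSpace ℝ (Fin d)}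

theorem IsMonotoneClipping.integrable_comp {Ω : Type*} [MeasurableSpace Ω] {μ : Measure Ω}
    [IsFiniteMeasure μ] (hΨ : IsMonotoneClipping R K Ψ) {w : Ω → EuclideanSpace ℝ (Fin d)}
    (hw : AEMeasurable w μ) : Integrable (fun ω => Ψ (w ω)) μ :=
  Integrable.of_bound
    (hΨ.lipschitz.continuous.measurable.comp_aemeasurable hw).aestronglyMeasurable R
    (Filter.Eventually.of_forall fun _ => hΨ.bound _)

theorem IsMonotoneClipping.inner_denoised [IsProbabilityMeasure (noiseLaw P)]
    (hΨ : IsMonotoneClipping R K Ψ) (v u : EuclideanSpace ℝ (Fin d)) :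
    inner ℝ (denoised Ψ P v) u
      = ∫ z, inner ℝ (Ψ (v + (z.1 - z.2))) u ∂((noiseLaw P).prod (noiseLaw P)) := by
  rw [denoised, real_inner_comm, ← integral_inner (hΨ.integrable_comp (by fun_prop))]
  simp_rw [real_inner_comm u]

/-- Swapping `z₁` and `z₂` changes the sign of the difference; oddness of `Ψ` then lets the two
expressions for the inner product be averaged, so that monotonicity applies pointwise. -/
theorem IsMonotoneClipping.two_mul_inner_denoised [IsProbabilityMeasure (noiseLaw P)]
    (hΨ : IsMonotoneClipping R K Ψ) (v : EuclideanSpace ℝ (Fin d)) :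
    2 * inner ℝ (denoised Ψ P v) v
      = ∫ z, inner ℝ (Ψ ((z.1 - z.2) + v) - Ψ ((z.1 - z.2) - v)) v
          ∂((noiseLaw P).prod (noiseLaw P)) := by
  have h1 := hΨ.inner_denoised (P := P) v v
  have h2 : inner ℝ (denoised Ψ P v) v
      = ∫ z, -inner ℝ (Ψ ((z.1 - z.2) - v)) v ∂((noiseLaw P).prod (noiseLaw P)) := by
    rw [h1, ← integral_prod_swap]
    refine integral_congr_ae (Filter.Eventually.of_forall fun z => ?_)
    simp only [Prod.fst_swap, Prod.snd_swap]
    rw [← inner_neg_left, ← hΨ.odd]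
    congr 2
    abel
  have h3 : Integrable (fun z => inner ℝ (Ψ (v + (z.1 - z.2))) v)
      ((noiseLaw P).prod (noiseLaw P)) :=
    (hΨ.integrable_comp (by fun_prop)).inner_const v
  have h4 : Integrable (fun z => inner ℝ (Ψ ((z.1 - z.2) - v)) v)
      ((noiseLaw P).prod (noiseLaw P)) :=
    (hΨ.integrable_comp (by fun_prop)).inner_const v
  have h5 := integral_add h3 h4.neg
  simp only [Pi.neg_apply] at h5
  rw [two_mul]
  nth_rewrite 1 [h1]
  rw [h2, ← h5]
  refine integral_congr_ae (Filter.Eventually.of_forall fun z => ?_)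
  simp only [inner_sub_left]
  rw [add_comm v, ← sub_eq_add_neg]

theorem IsMonotoneClipping.inner_denoised_ray [IsProbabilityMeasure (noiseLaw P)]
    (hΨ : IsMonotoneClipping R K Ψ) (v : EuclideanSpace ℝ (Fin d)) {c : ℝ} (hc : 1 ≤ c) :
    inner ℝ (denoised Ψ P v) v ≤ inner ℝ (denoised Ψ P (c • v)) v := by
  rw [hΨ.inner_denoised, hΨ.inner_denoised]
  refine integral_mono ((hΨ.integrable_comp (by fun_prop)).inner_const v)
    ((hΨ.integrable_comp (by fun_prop)).inner_const v) fun z => ?_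
  rcases hc.eq_or_lt with rfl | hc
  · simp
  · have h := hΨ.monotone (c • v + (z.1 - z.2)) (v + (z.1 - z.2))
    have h2 : c • v + (z.1 - z.2) - (v + (z.1 - z.2)) = (c - 1) • v := by
      rw [sub_smul, one_smul]; abel
    rw [h2, inner_smul_right, inner_sub_left] at h
    have := nonneg_of_mul_nonneg_right h (sub_pos.2 hc)
    simp only
    linarith

theorem IsMonotoneClipping.exists_alignmentConstants (hΨ : IsMonotoneClipping R K Ψ)
    (hP : IsNoiseDensity p σ P) : ∃ γ₁ γ₂ : ℝ, AreAlignmentConstants Ψ P γ₁ γ₂ := by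
  have := hP.isProbabilityMeasure
  obtain ⟨ε, hε, hcharge⟩ := hP.exists_difference_charges_ball
  obtain ⟨u, r, κ, hu, hr, hκ, hstr⟩ := hΨ.strong ε hε
  set S := {z : EuclideanSpace ℝ (Fin d) × EuclideanSpace ℝ (Fin d) | ‖(z.1 - z.2) - u‖ < r}
    with hS
  have hSm : MeasurableSet S := measurableSet_lt (by fun_prop) (by fun_prop)
  set q := κ * ((noiseLaw P).prod (noiseLaw P)).real S / 2 with hq
  have hq0 : 0 < q := by
    have : 0 < ((noiseLaw P).prod (noiseLaw P)).real S :=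
      ENNReal.toReal_pos (hcharge u r hu hr).ne' (measure_ne_top _ _)
    positivity
  have hloc : ∀ v : EuclideanSpace ℝ (Fin d), ‖v‖ < r →
      q * ‖v‖ ^ 2 ≤ inner ℝ (denoised Ψ P v) v := by
    intro v hv
    have h : ∫ z, S.indicator (fun _ => κ * ‖v‖ ^ 2) z ∂((noiseLaw P).prod (noiseLaw P))
        ≤ 2 * inner ℝ (denoised Ψ P v) v := by
      rw [hΨ.two_mul_inner_denoised]
      refine integral_mono ((integrable_const _).indicator hSm)
        (((hΨ.integrable_comp (by fun_prop)).sub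
          (hΨ.integrable_comp (by fun_prop))).inner_const v) fun z => ?_
      by_cases hz : z ∈ S
      · simp only [Set.indicator_of_mem hz]
        exact hstr _ v hz hv
      · simp only [Set.indicator_of_notMem hz]
        have h := hΨ.monotone (z.1 - z.2 + v) (z.1 - z.2 - v)
        have h2 : (z.1 - z.2 + v) - (z.1 - z.2 - v) = (2 : ℝ) • v := by rw [two_smul]; abel
        rw [h2, inner_smul_right] at h
        linarith
    rw [integral_indicator_const _ hSm, smul_eq_mul] at h
    rw [hq]
    linarith
  -- For `‖v‖ ≥ r`, shrink `v` to norm `r / 2`, where the quadratic bound holds, and return along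
  -- the ray; the scaling factor `2‖v‖ / r` produces `q * r / 2`.
  refine ⟨q * r / 2, q, by positivity, hq0, fun v => ?_⟩
  rcases lt_or_ge ‖v‖ r with hv | hv
  · exact (min_le_right _ _).trans (hloc v hv)
  · refine (min_le_left _ _).trans ?_
    have hv0 : 0 < ‖v‖ := hr.trans_le hv
    set c := 2 * ‖v‖ / r with hc
    have hc1 : 1 ≤ c := by rw [hc, le_div_iff₀ hr]; linarith
    have hc0 : 0 < c := by linarith
    have hcv : v = c • (c⁻¹ • v) := by rw [smul_smul, mul_inv_cancel₀ hc0.ne', one_smul]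
    have hn : ‖c⁻¹ • v‖ = r / 2 := by
      rw [norm_smul, norm_inv, Real.norm_of_nonneg hc0.le, hc]
      field_simp
    have h1 := hloc (c⁻¹ • v) (by rw [hn]; linarith)
    have h2 := hΨ.inner_denoised_ray (P := P) (c⁻¹ • v) hc1
    rw [← hcv] at h2
    have h3 : inner ℝ (denoised Ψ P v) v = c * inner ℝ (denoised Ψ P v) (c⁻¹ • v) := by
      rw [inner_smul_right, ← mul_assoc, mul_inv_cancel₀ hc0.ne', one_mul]
    rw [h3]
    rw [hn] at h1
    calc q * r / 2 * ‖v‖ = c * (q * (r / 2) ^ 2) := by rw [hc]; field_simp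
      _ ≤ _ := mul_le_mul_of_nonneg_left (h1.trans h2) hc0.le

end Alignment

/-! ### The mean of a batch of heavy-tailed vectors -/

section MiniBatch

variable {d : ℕ} {p σ : ℝ} {m : Measure (EuclideanSpace ℝ (Fin d))}

/-- The vector `z` if its norm is at most `τ`, and zero otherwise. -/
noncomputable def truncateNorm {E : Type*} [NormedAddCommGroup E] (τ : ℝ) (z : E) : E :=
  {z : E | ‖z‖ ≤ τ}.indicator id z

theorem measurable_truncateNorm {E : Type*} [NormedAddCommGroup E] [MeasurableSpace E]
    [BorelSpace E] (τ : ℝ) : Measurable (truncateNorm τ : E → E) :=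
  measurable_id.indicator (isClosed_le continuous_norm continuous_const).measurableSet

theorem norm_truncateNorm_le {E : Type*} [NormedAddCommGroup E] {τ : ℝ} (hτ : 0 ≤ τ) (z : E) :
    ‖truncateNorm τ z‖ ≤ τ := by
  by_cases h : z ∈ {z : E | ‖z‖ ≤ τ}
  · rw [truncateNorm, Set.indicator_of_mem h]; exact h
  · rw [truncateNorm, Set.indicator_of_notMem h, norm_zero]; exact hτ

theorem norm_truncateNorm_sq_le {E : Type*} [NormedAddCommGroup E] {τ : ℝ} (hτ : 0 < τ)
    (hp2 : p ≤ 2) (z : E) : ‖truncateNorm τ z‖ ^ 2 ≤ τ ^ (2 - p) * ‖z‖ ^ p := by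
  by_cases h : z ∈ {z : E | ‖z‖ ≤ τ}
  · rw [truncateNorm, Set.indicator_of_mem h, id]
    rcases (norm_nonneg z).eq_or_lt with h0 | h0
    · rw [← h0, zero_pow two_ne_zero]; positivity
    · calc ‖z‖ ^ 2 = ‖z‖ ^ (2 - p) * ‖z‖ ^ p := by
            rw [← Real.rpow_add h0, sub_add_cancel, Real.rpow_two]
        _ ≤ τ ^ (2 - p) * ‖z‖ ^ p := by
            gcongr ?_ * _
            exact Real.rpow_le_rpow h0.le h (by linarith)
  · rw [truncateNorm, Set.indicator_of_notMem h, norm_zero, zero_pow two_ne_zero]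
    positivity

theorem norm_sub_truncateNorm_le {E : Type*} [NormedAddCommGroup E] {τ : ℝ} (hτ : 0 < τ)
    (hp1 : 1 < p) (z : E) : ‖z - truncateNorm τ z‖ ≤ τ ^ (1 - p) * ‖z‖ ^ p := by
  by_cases h : z ∈ {z : E | ‖z‖ ≤ τ}
  · rw [truncateNorm, Set.indicator_of_mem h, id, sub_self, norm_zero]
    positivity
  · rw [truncateNorm, Set.indicator_of_notMem h, sub_zero]
    have hz : τ < ‖z‖ := not_le.1 h
    have h0 : 0 < ‖z‖ := hτ.trans hz
    calc ‖z‖ = ‖z‖ ^ (1 - p) * ‖z‖ ^ p := by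
          rw [← Real.rpow_add h0, sub_add_cancel, Real.rpow_one]
      _ ≤ τ ^ (1 - p) * ‖z‖ ^ p := by
          gcongr ?_ * _
          exact Real.rpow_le_rpow_of_nonpos hτ hz.le (by linarith)

theorem integrable_norm_rpow_of_lintegral_le {b : ℝ}
    (hmom : ∫⁻ z, ENNReal.ofReal (‖z‖ ^ p) ∂m ≤ ENNReal.ofReal b) :
    Integrable (fun z => ‖z‖ ^ p) m := by
  refine ⟨Measurable.aestronglyMeasurable (by fun_prop), ?_⟩
  rw [hasFiniteIntegral_iff_ofReal
    (Filter.Eventually.of_forall fun z => Real.rpow_nonneg (norm_nonneg z) p)]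
  exact hmom.trans_lt ENNReal.ofReal_lt_top

theorem integral_norm_rpow_le {b : ℝ} (hb : 0 ≤ b)
    (hmom : ∫⁻ z, ENNReal.ofReal (‖z‖ ^ p) ∂m ≤ ENNReal.ofReal b) :
    ∫ z, ‖z‖ ^ p ∂m ≤ b := by
  rw [integral_eq_lintegral_of_nonneg_ae
    (Filter.Eventually.of_forall fun z => Real.rpow_nonneg (norm_nonneg z) p)
    (Measurable.aestronglyMeasurable (by fun_prop))]
  exact ENNReal.toReal_le_of_le_ofReal hb hmom

theorem integrable_id_of_lintegral_norm_rpow_le [IsFiniteMeasure m] {b : ℝ} (hp1 : 1 < p)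
    (hmom : ∫⁻ z, ENNReal.ofReal (‖z‖ ^ p) ∂m ≤ ENNReal.ofReal b) :
    Integrable (fun z => z) m := by
  refine ((integrable_const 1).add (integrable_norm_rpow_of_lintegral_le hmom)).mono'
    measurable_id.aestronglyMeasurable (Filter.Eventually.of_forall fun z => ?_)
  simp only [Pi.add_apply]
  rcases le_total ‖z‖ 1 with h | h
  · have := Real.rpow_nonneg (norm_nonneg z) p
    linarith
  · have := Real.self_le_rpow_of_one_le h hp1.le
    linarith

theorem sq_integral_le_integral_sq {Ω : Type*} [MeasurableSpace Ω] {μ : Measure Ω}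
    [IsProbabilityMeasure μ] {X : Ω → ℝ} (hX : MemLp X 2 μ) :
    (∫ ω, X ω ∂μ) ^ 2 ≤ ∫ ω, X ω ^ 2 ∂μ := by
  have h1 := variance_eq_sub hX
  have h2 := variance_nonneg X μ
  simp only [Pi.pow_apply] at h1
  linarith

/-- Coordinatewise, the variance of a sum of pairwise independent variables is the sum of the
variances, each at most the second moment. -/
theorem integral_norm_sum_sub_sq_le {Ω ι : Type*} [MeasurableSpace Ω] {μ : Measure Ω}
    [IsProbabilityMeasure μ] {Y : ι → Ω → EuclideanSpace ℝ (Fin d)} {s : Finset ι}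
    {b : EuclideanSpace ℝ (Fin d)} {τ : ℝ} (hY : ∀ j ∈ s, AEMeasurable (Y j) μ)
    (hbdd : ∀ j ∈ s, ∀ ω, ‖Y j ω‖ ≤ τ) (hb : ∀ j ∈ s, ∫ ω, Y j ω ∂μ = b)
    (hind : (s : Set ι).Pairwise fun i j => IndepFun (Y i) (Y j) μ) :
    ∫ ω, ‖∑ j ∈ s, (Y j ω - b)‖ ^ 2 ∂μ ≤ ∑ j ∈ s, ∫ ω, ‖Y j ω‖ ^ 2 ∂μ := by
  have hmi : ∀ i : Fin d, Measurable fun z : EuclideanSpace ℝ (Fin d) => z i := fun i => by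
    fun_prop
  have hL : ∀ i : Fin d, ∀ j ∈ s, MemLp (fun ω => Y j ω i) 2 μ := fun i j hj =>
    MemLp.of_bound ((hmi i).comp_aemeasurable (hY j hj)).aestronglyMeasurable τ
      (Filter.Eventually.of_forall fun ω => (PiLp.norm_apply_le (Y j ω) i).trans (hbdd j hj ω))
  have hint : ∀ j ∈ s, Integrable (Y j) μ := fun j hj =>
    Integrable.of_bound (hY j hj).aestronglyMeasurable τ (Filter.Eventually.of_forall (hbdd j hj))
  have hbi : ∀ i : Fin d, ∀ j ∈ s, ∫ ω, Y j ω i ∂μ = b i := fun i j hj => by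
    rw [← hb j hj]
    exact (EuclideanSpace.proj (𝕜 := ℝ) i).integral_comp_comm (hint j hj)
  have hS : ∀ i : Fin d, MemLp (fun ω => ∑ j ∈ s, Y j ω i) 2 μ := fun i => memLp_finsetSum s (hL i)
  have hSb : ∀ i : Fin d, ∫ ω, ∑ j ∈ s, Y j ω i ∂μ = ∑ j ∈ s, b i := fun i => by
    rw [integral_finsetSum s fun j hj => (hL i j hj).integrable one_le_two]
    exact Finset.sum_congr rfl fun j hj => hbi i j hj
  have hvar : ∀ i : Fin d, ∫ ω, (∑ j ∈ s, (Y j ω - b) i) ^ 2 ∂μ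
      ≤ ∑ j ∈ s, ∫ ω, (Y j ω i) ^ 2 ∂μ := fun i => by
    calc ∫ ω, (∑ j ∈ s, (Y j ω - b) i) ^ 2 ∂μ
        = Var[fun ω => ∑ j ∈ s, Y j ω i; μ] := by
          rw [variance_eq_integral (hS i).aemeasurable, hSb]
          refine integral_congr_ae (Filter.Eventually.of_forall fun ω => ?_)
          simp only [PiLp.sub_apply, Finset.sum_sub_distrib]
      _ = ∑ j ∈ s, Var[fun ω => Y j ω i; μ] := by
          have := IndepFun.variance_sum (X := fun j ω => Y j ω i) (hL i)
            fun j hj k hk hjk => (hind hj hk hjk).comp (hmi i) (hmi i)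
          rw [← this]
          congr 1
          ext ω
          simp
      _ ≤ _ := Finset.sum_le_sum fun j hj =>
          variance_le_expectation_sq (hL i j hj).aestronglyMeasurable
  have hdev : ∀ i : Fin d, MemLp (fun ω => ∑ j ∈ s, (Y j ω - b) i) 2 μ := fun i =>
    memLp_finsetSum s fun j hj => (hL i j hj).sub (memLp_const (b i))
  calc ∫ ω, ‖∑ j ∈ s, (Y j ω - b)‖ ^ 2 ∂μ
      = ∫ ω, ∑ i, (∑ j ∈ s, (Y j ω - b) i) ^ 2 ∂μ := by
        refine integral_congr_ae (Filter.Eventually.of_forall fun ω => ?_)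
        simp only [EuclideanSpace.real_norm_sq_eq, WithLp.ofLp_sum, Finset.sum_apply]
    _ = ∑ i, ∫ ω, (∑ j ∈ s, (Y j ω - b) i) ^ 2 ∂μ :=
        integral_finsetSum _ fun i _ => (hdev i).integrable_sq
    _ ≤ ∑ i, ∑ j ∈ s, ∫ ω, (Y j ω i) ^ 2 ∂μ := Finset.sum_le_sum fun i _ => hvar i
    _ = ∑ j ∈ s, ∑ i, ∫ ω, (Y j ω i) ^ 2 ∂μ := Finset.sum_comm
    _ = ∑ j ∈ s, ∫ ω, ‖Y j ω‖ ^ 2 ∂μ := Finset.sum_congr rfl fun j hj => by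
        rw [← integral_finsetSum _ fun i _ => (hL i j hj).integrable_sq]
        simp only [EuclideanSpace.real_norm_sq_eq]

/-- The mean of a batch of independent centred vectors with bounded `p`-th moment is small. -/
theorem integral_norm_batch_mean_le [IsProbabilityMeasure m] {Ω ι : Type*} [MeasurableSpace Ω]
    {μ : Measure Ω} [IsProbabilityMeasure μ] (hp1 : 1 < p) (hp2 : p ≤ 2) (hσ : 0 < σ)
    (hmom : ∫⁻ z, ENNReal.ofReal (‖z‖ ^ p) ∂m ≤ ENNReal.ofReal (σ ^ p)) (hmean : ∫ z, z ∂m = 0)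
    {Z : ι → Ω → EuclideanSpace ℝ (Fin d)} {s : Finset ι} (hZ : ∀ j ∈ s, HasLaw (Z j) m μ)
    (hind : (s : Set ι).Pairwise fun i j => IndepFun (Z i) (Z j) μ)
    {r : ℝ} (hr : 0 < r) (hrs : r ^ p ≤ (s.card : ℝ)) :
    ∫ ω, ‖(1 / (s.card : ℝ)) • ∑ j ∈ s, Z j ω‖ ∂μ ≤ 3 * σ * r ^ (1 - p) := by
  have hB : 0 < (s.card : ℝ) := (Real.rpow_pos_of_pos hr p).trans_le hrs
  set B : ℝ := (s.card : ℝ) with hBdef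
  -- The noise may have no second moment, hence truncation. This level balances the two errors: the
  -- centred truncated part, the tails and the truncation bias each contribute `σ * r ^ (1 - p)`,
  -- whence the factor 3.
  set τ := σ * r with hτdef
  have hτ : 0 < τ := mul_pos hσ hr
  have hip := integrable_norm_rpow_of_lintegral_le hmom
  have hip' := integral_norm_rpow_le (Real.rpow_nonneg hσ.le p) hmom
  have hid := integrable_id_of_lintegral_norm_rpow_le hp1 hmom
  have hTm : Measurable (truncateNorm τ : EuclideanSpace ℝ (Fin d) → _) := measurable_truncateNorm τ
  have hTi : Integrable (fun z => truncateNorm τ z) m :=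
    Integrable.of_bound hTm.aestronglyMeasurable τ
      (Filter.Eventually.of_forall fun z => norm_truncateNorm_le hτ.le z)
  have hTi2 : Integrable (fun z => ‖truncateNorm τ z‖ ^ 2) m :=
    (MemLp.of_bound hTm.aestronglyMeasurable τ
      (Filter.Eventually.of_forall fun z => norm_truncateNorm_le hτ.le z)).norm.integrable_sq
  set b := ∫ z, truncateNorm τ z ∂m with hb
  have htail : ∫ z, ‖z - truncateNorm τ z‖ ∂m ≤ σ * r ^ (1 - p) := by
    calc ∫ z, ‖z - truncateNorm τ z‖ ∂m ≤ ∫ z, τ ^ (1 - p) * ‖z‖ ^ p ∂m :=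
          integral_mono (hid.sub hTi).norm (hip.const_mul _)
            fun z => norm_sub_truncateNorm_le hτ hp1 z
      _ = τ ^ (1 - p) * ∫ z, ‖z‖ ^ p ∂m := integral_const_mul _ _
      _ ≤ τ ^ (1 - p) * σ ^ p := mul_le_mul_of_nonneg_left hip' (by positivity)
      _ = σ * r ^ (1 - p) := by
          rw [hτdef, Real.mul_rpow hσ.le hr.le, mul_right_comm, ← Real.rpow_add hσ,
            sub_add_cancel, Real.rpow_one]
  have hbn : ‖b‖ ≤ σ * r ^ (1 - p) := by
    -- The noise is centred, so the truncation bias is minus the mean of the discarded tail.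
    have : b = -∫ z, (z - truncateNorm τ z) ∂m := by
      rw [integral_sub hid hTi, hmean, zero_sub, neg_neg]
    rw [this, norm_neg]
    exact (norm_integral_le_integral_norm _).trans htail
  have hsq : ∫ z, ‖truncateNorm τ z‖ ^ 2 ∂m ≤ σ ^ 2 * r ^ (2 - p) := by
    calc ∫ z, ‖truncateNorm τ z‖ ^ 2 ∂m ≤ ∫ z, τ ^ (2 - p) * ‖z‖ ^ p ∂m :=
          integral_mono hTi2 (hip.const_mul _) fun z => norm_truncateNorm_sq_le hτ hp2 z
      _ = τ ^ (2 - p) * ∫ z, ‖z‖ ^ p ∂m := integral_const_mul _ _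
      _ ≤ τ ^ (2 - p) * σ ^ p := mul_le_mul_of_nonneg_left hip' (by positivity)
      _ = σ ^ 2 * r ^ (2 - p) := by
          rw [hτdef, Real.mul_rpow hσ.le hr.le, mul_right_comm, ← Real.rpow_add hσ,
            sub_add_cancel, Real.rpow_two]
  have hYm : ∀ j ∈ s, AEMeasurable (fun ω => truncateNorm τ (Z j ω)) μ := fun j hj =>
    hTm.comp_aemeasurable (hZ j hj).aemeasurable
  have hYL : ∀ j ∈ s, MemLp (fun ω => truncateNorm τ (Z j ω)) 2 μ := fun j hj =>
    MemLp.of_bound (hYm j hj).aestronglyMeasurable τ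
      (Filter.Eventually.of_forall fun ω => norm_truncateNorm_le hτ.le _)
  have hbulk2 : ∫ ω, ‖∑ j ∈ s, (truncateNorm τ (Z j ω) - b)‖ ^ 2 ∂μ
      ≤ B * (σ ^ 2 * r ^ (2 - p)) := by
    refine (integral_norm_sum_sub_sq_le (Y := fun j ω => truncateNorm τ (Z j ω)) hYm
      (fun j _ ω => norm_truncateNorm_le hτ.le _)
      (fun j hj => (hZ j hj).integral_comp hTm.aestronglyMeasurable)
      fun i hi j hj hij => (hind hi hj hij).comp hTm hTm).trans ?_
    rw [hBdef, ← nsmul_eq_mul]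
    refine Finset.sum_le_card_nsmul _ _ _ fun j hj => ?_
    refine le_trans (le_of_eq ?_) hsq
    exact (hZ j hj).integral_comp (f := fun z => ‖truncateNorm τ z‖ ^ 2)
      hTi2.aestronglyMeasurable
  have hbL : MemLp (fun ω => ∑ j ∈ s, (truncateNorm τ (Z j ω) - b)) 2 μ :=
    memLp_finsetSum s fun j hj => (hYL j hj).sub (memLp_const b)
  have hbulk : ∫ ω, ‖∑ j ∈ s, (truncateNorm τ (Z j ω) - b)‖ ∂μ ≤ B * (σ * r ^ (1 - p)) := by
    refine (sq_le_sq₀ (integral_nonneg fun _ => norm_nonneg _) (by positivity)).1 ?_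
    refine (sq_integral_le_integral_sq hbL.norm).trans (hbulk2.trans ?_)
    have h1 : r ^ (2 - p) = r ^ p * (r ^ (1 - p)) ^ 2 := by
      rw [← Real.rpow_natCast (r ^ (1 - p)), ← Real.rpow_mul hr.le, ← Real.rpow_add hr]
      congr 1
      push_cast
      ring
    calc B * (σ ^ 2 * r ^ (2 - p)) = r ^ p * (B * (σ * r ^ (1 - p)) ^ 2) := by rw [h1]; ring
      _ ≤ B * (B * (σ * r ^ (1 - p)) ^ 2) := mul_le_mul_of_nonneg_right hrs (by positivity)
      _ = (B * (σ * r ^ (1 - p))) ^ 2 := by ring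
  have hZi : ∀ j ∈ s, Integrable (Z j) μ := fun j hj => by
    have h := hid
    rw [← (hZ j hj).map_eq] at h
    exact h.comp_aemeasurable (hZ j hj).aemeasurable
  have hti : ∀ j ∈ s, Integrable (fun ω => ‖Z j ω - truncateNorm τ (Z j ω)‖) μ := fun j hj =>
    ((hZi j hj).sub ((hYL j hj).integrable one_le_two)).norm
  have htj : ∀ j ∈ s, ∫ ω, (‖Z j ω - truncateNorm τ (Z j ω)‖ + ‖b‖) ∂μ
      ≤ 2 * (σ * r ^ (1 - p)) := fun j hj => by
    rw [integral_add (hti j hj) (integrable_const _), integral_const, probReal_univ, one_smul]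
    have h1 : ∫ ω, ‖Z j ω - truncateNorm τ (Z j ω)‖ ∂μ = ∫ z, ‖z - truncateNorm τ z‖ ∂m :=
      (hZ j hj).integral_comp (f := fun z => ‖z - truncateNorm τ z‖)
        (hid.sub hTi).norm.aestronglyMeasurable
    linarith
  have hrest : ∫ ω, ∑ j ∈ s, (‖Z j ω - truncateNorm τ (Z j ω)‖ + ‖b‖) ∂μ
      ≤ B * (2 * (σ * r ^ (1 - p))) := by
    have hi : ∀ j ∈ s, Integrable (fun ω => ‖Z j ω - truncateNorm τ (Z j ω)‖ + ‖b‖) μ :=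
      fun j hj => (hti j hj).add (integrable_const _)
    rw [integral_finsetSum s hi, hBdef, ← nsmul_eq_mul]
    exact Finset.sum_le_card_nsmul _ _ _ htj
  have hsum : ∫ ω, ‖∑ j ∈ s, Z j ω‖ ∂μ ≤ B * (3 * σ * r ^ (1 - p)) := by
    have hi1 := (hbL.integrable one_le_two).norm
    have hi2 : Integrable (fun ω => ∑ j ∈ s, (‖Z j ω - truncateNorm τ (Z j ω)‖ + ‖b‖)) μ :=
      integrable_finsetSum s fun j hj => (hti j hj).add (integrable_const _)
    calc ∫ ω, ‖∑ j ∈ s, Z j ω‖ ∂μ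
        ≤ ∫ ω, (‖∑ j ∈ s, (truncateNorm τ (Z j ω) - b)‖
            + ∑ j ∈ s, (‖Z j ω - truncateNorm τ (Z j ω)‖ + ‖b‖)) ∂μ := by
          refine integral_mono (integrable_finsetSum s hZi).norm (hi1.add hi2) fun ω => ?_
          have : ∑ j ∈ s, Z j ω = ∑ j ∈ s, (truncateNorm τ (Z j ω) - b)
              + ∑ j ∈ s, ((Z j ω - truncateNorm τ (Z j ω)) + b) := by
            rw [← Finset.sum_add_distrib]
            exact Finset.sum_congr rfl fun j _ => by abel
          simp only
          rw [this]
          refine (norm_add_le _ _).trans (add_le_add_right ?_ _)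
          exact (norm_sum_le _ _).trans (Finset.sum_le_sum fun j _ => norm_add_le _ _)
      _ ≤ B * (σ * r ^ (1 - p)) + B * (2 * (σ * r ^ (1 - p))) := by
          rw [integral_add hi1 hi2]; exact add_le_add hbulk hrest
      _ = B * (3 * σ * r ^ (1 - p)) := by ring
  simp_rw [norm_smul]
  rw [integral_const_mul, Real.norm_of_nonneg (by positivity), one_div,
    inv_mul_le_iff₀ hB]
  exact hsum

end MiniBatch

/-! ### The exponential moment recursion along the iterates -/

section Recursion

/-- The descent inequality for a function with Lipschitz gradient. -/
theorem apply_add_le_of_lipschitz_gradient {E : Type*} [NormedAddCommGroup E]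
    [InnerProductSpace ℝ E] [CompleteSpace E] {F : E → ℝ} {L : ℝ≥0} (hF : Differentiable ℝ F)
    (hL : LipschitzWith L (gradient F)) (x h : E) :
    F (x + h) ≤ F x + inner ℝ (gradient F x) h + L * ‖h‖ ^ 2 := by
  have key := (convex_closedBall x ‖h‖).norm_image_sub_le_of_norm_hasFDerivWithin_le'
    (f := F) (f' := fun z => InnerProductSpace.toDual ℝ E (gradient F z))
    (φ := InnerProductSpace.toDual ℝ E (gradient F x)) (C := L * ‖h‖)
    (x := x) (y := x + h)
    (fun z _ => (hF z).hasGradientAt.hasFDerivAt.hasFDerivWithinAt)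
    (fun z hz => by
      rw [← map_sub, LinearIsometryEquiv.norm_map, ← dist_eq_norm]
      exact (hL.dist_le_mul z x).trans
        (mul_le_mul_of_nonneg_left (Metric.mem_closedBall.1 hz) L.coe_nonneg))
    (Metric.mem_closedBall_self (norm_nonneg h)) (by simp)
  rw [add_sub_cancel_left, InnerProductSpace.toDual_apply_apply] at key
  have := (le_abs_self _).trans key
  nlinarith

/-- Integrate `e^X ≤ 1 + X + X²`, valid for `|X| ≤ 1`, and use `1 + s ≤ e^s`. -/
theorem lintegral_exp_le {Ω : Type*} [MeasurableSpace Ω] {μ : Measure Ω} [IsProbabilityMeasure μ]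
    {X : Ω → ℝ} (hX : AEMeasurable X μ) {c : ℝ} (hc : c ≤ 1) (hXc : ∀ ω, |X ω| ≤ c) :
    ∫⁻ ω, ENNReal.ofReal (Real.exp (X ω)) ∂μ
      ≤ ENNReal.ofReal (Real.exp (∫ ω, X ω ∂μ + c ^ 2)) := by
  have hXi : Integrable X μ := Integrable.of_bound hX.aestronglyMeasurable c
    (Filter.Eventually.of_forall hXc)
  have hei : Integrable (fun ω => Real.exp (X ω)) μ :=
    Integrable.of_bound (Real.measurable_exp.comp_aemeasurable hX).aestronglyMeasurable
      (Real.exp c) (Filter.Eventually.of_forall fun ω => by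
        rw [Real.norm_of_nonneg (Real.exp_pos _).le]
        exact Real.exp_le_exp.2 ((le_abs_self _).trans (hXc ω)))
  rw [← ofReal_integral_eq_lintegral_ofReal hei
    (Filter.Eventually.of_forall fun ω => (Real.exp_pos _).le)]
  refine ENNReal.ofReal_le_ofReal ?_
  have hq : Integrable (fun ω => X ω + (c ^ 2 + 1)) μ := hXi.add (integrable_const _)
  calc ∫ ω, Real.exp (X ω) ∂μ ≤ ∫ ω, (X ω + (c ^ 2 + 1)) ∂μ := by
        refine integral_mono hei hq fun ω => ?_
        have h1 := (abs_le.1 (Real.abs_exp_sub_one_sub_id_le ((hXc ω).trans hc))).2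
        have h2 : X ω ^ 2 ≤ c ^ 2 := by
          rw [← sq_abs]; exact pow_le_pow_left₀ (abs_nonneg _) (hXc ω) 2
        simp only
        linarith
    _ = (∫ ω, X ω ∂μ + c ^ 2) + 1 := by
        rw [integral_add hXi (integrable_const _), integral_const, probReal_univ, one_smul]
        ring
    _ ≤ _ := Real.add_one_le_exp _

/-- Plays the role of conditioning on the history `Y`: the history is frozen while the fresh noise
is integrated out. -/
theorem lintegral_of_indepFun {Ω α β : Type*} [MeasurableSpace Ω] {μ : Measure Ω}
    [IsProbabilityMeasure μ] [MeasurableSpace α] [MeasurableSpace β] {Y : Ω → α} {W : Ω → β}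
    (hY : AEMeasurable Y μ) (hW : AEMeasurable W μ) (h : IndepFun Y W μ) {f : α × β → ℝ≥0∞}
    (hf : Measurable f) :
    ∫⁻ ω, f (Y ω, W ω) ∂μ = ∫⁻ ω, ∫⁻ ω', f (Y ω, W ω') ∂μ ∂μ := by
  rw [← lintegral_map' hf.aemeasurable (hY.prodMk hW),
    (indepFun_iff_map_prod_eq_prod_map_map hY hW).1 h]
  have := Measure.isProbabilityMeasure_map hY
  have := Measure.isProbabilityMeasure_map hW
  rw [lintegral_prod _ hf.aemeasurable, lintegral_map' (hf.lintegral_prod_right').aemeasurable hY]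
  refine lintegral_congr fun ω => ?_
  exact lintegral_map' (f := fun y => f (Y ω, y)) (hf.comp measurable_prodMk_left).aemeasurable hW

/-- Extension by zero of a family indexed by a finite set of naturals. -/
def extendZero {E : Type*} [Zero E] (s : Finset ℕ) (h : s → E) (k : ℕ) : E :=
  if hk : k ∈ s then h ⟨k, hk⟩ else 0

theorem measurable_extendZero {E : Type*} [Zero E] [MeasurableSpace E] (s : Finset ℕ) (k : ℕ) :
    Measurable fun h : s → E => extendZero s h k := by
  by_cases hk : k ∈ s
  · simp only [extendZero, hk, dif_pos]
    exact measurable_pi_apply _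
  · simp only [extendZero, hk]
    exact measurable_const

theorem extendZero_of_mem {E : Type*} [Zero E] {s : Finset ℕ} {k : ℕ} (hk : k ∈ s)
    (h : ℕ → E) : extendZero s (fun j => h j) k = h k := by
  simp only [extendZero, hk, dif_pos]

variable {d : ℕ} {R : ℝ} {K L : ℝ≥0}
  {Ψ : EuclideanSpace ℝ (Fin d) → EuclideanSpace ℝ (Fin d)}
  {F : EuclideanSpace ℝ (Fin d) → ℝ} {Ω : Type*} [MeasurableSpace Ω] {μ : Measure Ω}
  {x W : ℕ → Ω → EuclideanSpace ℝ (Fin d)} {x₁ : EuclideanSpace ℝ (Fin d)} {α : ℕ → ℝ}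

theorem aemeasurable_iterate (hΨ : Measurable Ψ) (hg : Measurable (gradient F))
    (hx1 : ∀ ω, x 1 ω = x₁)
    (hx : ∀ t, 1 ≤ t → ∀ ω, x (t + 1) ω = x t ω - α t • Ψ (gradient F (x t ω) + W t ω))
    (hW : ∀ t, 1 ≤ t → AEMeasurable (W t) μ) : ∀ t, 1 ≤ t → AEMeasurable (x t) μ := by
  intro t ht
  induction t, ht using Nat.le_induction with
  | base => rw [funext hx1]; exact aemeasurable_const
  | succ t ht ih =>
    rw [funext (hx t ht)]
    have h : AEMeasurable (fun ω => Ψ (gradient F (x t ω) + W t ω)) μ :=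
      hΨ.comp_aemeasurable ((hg.comp_aemeasurable ih).add (hW t ht))
    exact ih.sub (h.const_smul (α t))

/-- The exponential of the compensated cost has expectation at most one. -/
theorem lintegral_exp_compensated_cost_le_one [IsProbabilityMeasure μ]
    (hΨ : IsMonotoneClipping R K Ψ) (hF : Differentiable ℝ F)
    (hL : LipschitzWith L (gradient F)) (hx1 : ∀ ω, x 1 ω = x₁)
    (hx : ∀ t, 1 ≤ t → ∀ ω, x (t + 1) ω = x t ω - α t • Ψ (gradient F (x t ω) + W t ω))
    (hW : ∀ t, 1 ≤ t → AEMeasurable (W t) μ)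
    (hind : ∀ t, 1 ≤ t → IndepFun (fun ω (k : Finset.Icc 1 t) => x k ω) (W t) μ)
    {lam G : ℝ} (hlam : 0 ≤ lam) {D : ℕ → EuclideanSpace ℝ (Fin d) → ℝ}
    (hD : ∀ t, Measurable (D t))
    (hG : ∀ t, 1 ≤ t → ∀ ω, α t * ‖gradient F (x t ω)‖ ≤ G)
    (hmgf : ∀ t, 1 ≤ t → ∀ v, α t * ‖v‖ ≤ G →
      ∫⁻ ω, ENNReal.ofReal (Real.exp (-(lam * α t * inner ℝ v (Ψ (v + W t ω))))) ∂μ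
        ≤ ENNReal.ofReal (Real.exp (-(lam * D t v)))) (t : ℕ) :
    ∫⁻ ω, ENNReal.ofReal (Real.exp (lam * (F (x (t + 1) ω) - F x₁
        + ∑ k ∈ Finset.Icc 1 t, (D k (gradient F (x k ω)) - L * (α k * R) ^ 2)))) ∂μ ≤ 1 := by
  have hΨm : Measurable Ψ := hΨ.lipschitz.continuous.measurable
  have hgm : Measurable (gradient F) := hL.continuous.measurable
  have hFm : Measurable F := hF.continuous.measurable
  have hxm := aemeasurable_iterate hΨm hgm hx1 hx hW
  induction t with
  | zero => simp [hx1]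
  | succ s ih =>
    set t := s + 1 with htdef
    have ht : 1 ≤ t := Nat.le_add_left 1 s
    set A : (Finset.Icc 1 t → EuclideanSpace ℝ (Fin d)) → ℝ≥0∞ := fun h =>
      ENNReal.ofReal (Real.exp (lam * (F (extendZero _ h t) - F x₁
        + ∑ k ∈ Finset.Icc 1 s, (D k (gradient F (extendZero _ h k)) - L * (α k * R) ^ 2)))) with hA
    have hem := measurable_extendZero (E := EuclideanSpace ℝ (Fin d)) (Finset.Icc 1 t)
    have hAm : Measurable A := by
      refine (Real.measurable_exp.comp (Measurable.const_mul (Measurable.add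
        ((hFm.comp (hem t)).sub_const _) ?_) lam)).ennreal_ofReal
      exact Finset.measurable_sum _ fun k _ =>
        ((hD k).comp (hgm.comp (hem k))).sub_const _
    set H : Ω → Finset.Icc 1 t → EuclideanSpace ℝ (Fin d) := fun ω k => x k ω with hH
    have hHm : AEMeasurable H μ := aemeasurable_pi_lambda _ fun k =>
      hxm k (Finset.mem_Icc.1 k.2).1
    have htm : t ∈ Finset.Icc 1 t := Finset.mem_Icc.2 ⟨ht, le_rfl⟩
    have hHt : ∀ ω, extendZero _ (H ω) t = x t ω := fun ω =>
      extendZero_of_mem htm fun k => x k ω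
    have hAH : ∀ ω, A (H ω) = ENNReal.ofReal (Real.exp (lam * (F (x t ω) - F x₁
        + ∑ k ∈ Finset.Icc 1 s, (D k (gradient F (x k ω)) - L * (α k * R) ^ 2)))) := by
      intro ω
      simp only [hA]
      rw [hHt, Finset.sum_congr rfl fun k hk => by
        rw [extendZero_of_mem (Finset.mem_Icc.2 ⟨(Finset.mem_Icc.1 hk).1,
          (Finset.mem_Icc.1 hk).2.trans (Nat.le_succ s)⟩) fun k => x k ω]]
    -- History and fresh noise as separate variables: only the last factor involves the noise, and
    -- integrating it cancels the factor with `D t`.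
    set f : (Finset.Icc 1 t → EuclideanSpace ℝ (Fin d)) × EuclideanSpace ℝ (Fin d) → ℝ≥0∞ :=
      fun q => (A q.1 * ENNReal.ofReal (Real.exp (lam * D t (gradient F (extendZero _ q.1 t)))))
        * ENNReal.ofReal (Real.exp (-(lam * α t * inner ℝ (gradient F (extendZero _ q.1 t))
            (Ψ (gradient F (extendZero _ q.1 t) + q.2))))) with hf
    have hg1 : Measurable fun q : (Finset.Icc 1 t → EuclideanSpace ℝ (Fin d)) ×
        EuclideanSpace ℝ (Fin d) => gradient F (extendZero _ q.1 t) :=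
      hgm.comp ((hem t).comp measurable_fst)
    have hfm : Measurable f := by
      refine Measurable.mul (Measurable.mul (hAm.comp measurable_fst) ?_) ?_
      · exact (Real.measurable_exp.comp (((hD t).comp hg1).const_mul lam)).ennreal_ofReal
      · exact (Real.measurable_exp.comp ((Measurable.inner hg1
          (hΨm.comp (hg1.add measurable_snd))).const_mul (lam * α t)).neg).ennreal_ofReal
    have hstep : ∀ ω, ENNReal.ofReal (Real.exp (lam * (F (x (t + 1) ω) - F x₁
        + ∑ k ∈ Finset.Icc 1 t, (D k (gradient F (x k ω)) - L * (α k * R) ^ 2))))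
        ≤ f (H ω, W t ω) := by
      intro ω
      simp only [hf]
      rw [hAH, hHt, ← ENNReal.ofReal_mul (Real.exp_pos _).le, ← Real.exp_add,
        ← ENNReal.ofReal_mul (Real.exp_pos _).le, ← Real.exp_add]
      refine ENNReal.ofReal_le_ofReal (Real.exp_le_exp.2 ?_)
      rw [Finset.sum_Icc_succ_top ht]
      have hdes := apply_add_le_of_lipschitz_gradient hF hL (x t ω)
        (-(α t • Ψ (gradient F (x t ω) + W t ω)))
      rw [← sub_eq_add_neg, ← hx t ht ω, norm_neg, norm_smul, inner_neg_right,
        inner_smul_right, mul_pow, Real.norm_eq_abs, sq_abs] at hdes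
      have hR2 : ‖Ψ (gradient F (x t ω) + W t ω)‖ ^ 2 ≤ R ^ 2 :=
        pow_le_pow_left₀ (norm_nonneg _) (hΨ.bound _) 2
      have h3 : (L : ℝ) * (α t ^ 2 * ‖Ψ (gradient F (x t ω) + W t ω)‖ ^ 2)
          ≤ L * (α t * R) ^ 2 := by
        rw [mul_pow]; gcongr
      have h4 := mul_le_mul_of_nonneg_left (hdes.trans (add_le_add_right h3 _)) hlam
      linarith
    calc _ ≤ ∫⁻ ω, f (H ω, W t ω) ∂μ := lintegral_mono hstep
      _ = ∫⁻ ω, ∫⁻ ω', f (H ω, W t ω') ∂μ ∂μ :=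
          lintegral_of_indepFun hHm (hW t ht) (hind t ht) hfm
      _ ≤ ∫⁻ ω, A (H ω) ∂μ := by
          refine lintegral_mono fun ω => ?_
          simp only [hf, hHt]
          have hm : AEMeasurable (fun ω' => ENNReal.ofReal (Real.exp (-(lam * α t *
              inner ℝ (gradient F (x t ω)) (Ψ (gradient F (x t ω) + W t ω')))))) μ :=
            (Real.measurable_exp.comp_aemeasurable (((hΨm.comp_aemeasurable
              ((hW t ht).const_add _)).const_inner).const_mul _).neg).ennreal_ofReal
          rw [lintegral_const_mul'' _ hm]
          calc _ ≤ (A (H ω) * ENNReal.ofReal (Real.exp (lam * D t (gradient F (x t ω)))))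
                * ENNReal.ofReal (Real.exp (-(lam * D t (gradient F (x t ω))))) := by
                gcongr
                exact hmgf t ht _ (hG t ht ω)
            _ = A (H ω) := by
                rw [mul_assoc, ← ENNReal.ofReal_mul (Real.exp_pos _).le, ← Real.exp_add,
                  add_neg_cancel, Real.exp_zero, ENNReal.ofReal_one, mul_one]
      _ ≤ 1 := by simp_rw [hAH]; exact ih

/-- Each step changes the gradient by at most `L * α t * R`, and these increments sum to `O(√t)`,
which `α t` compensates. The bound is sure, so no stopping argument is needed. -/
theorem step_norm_gradient_le {Ω : Type*} {x W : ℕ → Ω → EuclideanSpace ℝ (Fin d)}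
    (hΨ : IsMonotoneClipping R K Ψ)
    (hL : LipschitzWith L (gradient F)) (hx1 : ∀ ω, x 1 ω = x₁)
    (hx : ∀ t, 1 ≤ t → ∀ ω, x (t + 1) ω = x t ω - α t • Ψ (gradient F (x t ω) + W t ω))
    {a : ℝ} (hα0 : ∀ t, 0 ≤ α t) (hα : ∀ t : ℕ, α t ≤ a / √(t + 1 : ℝ)) (ha : 0 ≤ a)
    (ha1 : a ≤ 1) (t : ℕ) (ht : 1 ≤ t) (ω : Ω) :
    α t * ‖gradient F (x t ω)‖ ≤ a * ‖gradient F x₁‖ + 2 * (L * R) := by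
  have hR : 0 ≤ R := (norm_nonneg _).trans (hΨ.bound 0)
  have hgrow : ‖gradient F (x t ω)‖ ≤ ‖gradient F x₁‖ + 2 * (L * R) * a * √(t : ℝ) := by
    induction t, ht using Nat.le_induction with
    | base =>
      rw [hx1]
      have : 0 ≤ 2 * (L * R) * a * √((1 : ℕ) : ℝ) := by positivity
      linarith
    | succ t ht ih =>
      have h1 : ‖gradient F (x (t + 1) ω) - gradient F (x t ω)‖ ≤ L * (α t * R) := by
        rw [← dist_eq_norm]
        refine (hL.dist_le_mul _ _).trans (mul_le_mul_of_nonneg_left ?_ L.coe_nonneg)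
        rw [dist_eq_norm, hx t ht, sub_sub_cancel_left, norm_neg, norm_smul,
          Real.norm_of_nonneg (hα0 t)]
        exact mul_le_mul_of_nonneg_left (hΨ.bound _) (hα0 t)
      have h2 : ‖gradient F (x (t + 1) ω)‖
          ≤ ‖gradient F (x (t + 1) ω) - gradient F (x t ω)‖ + ‖gradient F (x t ω)‖ := by
        simpa using norm_add_le (gradient F (x (t + 1) ω) - gradient F (x t ω))
          (gradient F (x t ω))
      have hs0 : 0 < √((t : ℝ) + 1) := Real.sqrt_pos.2 (by positivity)
      have hsq1 : √((t : ℝ) + 1) ^ 2 = t + 1 := Real.sq_sqrt (by positivity)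
      have hsq0 : √(t : ℝ) ^ 2 = t := Real.sq_sqrt (by positivity)
      -- Telescoping form of the bound; after clearing the root it is `a * (√(t + 1) - √t)² ≥ 0`.
      have h3 : a / √((t : ℝ) + 1) ≤ 2 * a * (√((t : ℝ) + 1) - √(t : ℝ)) := by
        rw [div_le_iff₀ hs0]
        have : 0 ≤ a * (√((t : ℝ) + 1) - √(t : ℝ)) ^ 2 := by positivity
        nlinarith
      have h4 : (L : ℝ) * (α t * R) ≤ L * (2 * a * (√((t : ℝ) + 1) - √(t : ℝ)) * R) := by
        have := (hα t).trans h3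
        gcongr
      push_cast
      linarith
  have hs0 : 0 < √((t : ℝ) + 1) := Real.sqrt_pos.2 (by positivity)
  have hst : √(t : ℝ) ≤ √((t : ℝ) + 1) := Real.sqrt_le_sqrt (by linarith)
  have hs1 : 1 ≤ √((t : ℝ) + 1) := by
    rw [Real.one_le_sqrt]; linarith [(Nat.cast_nonneg t : (0 : ℝ) ≤ t)]
  have hα1 : α t ≤ a := (hα t).trans (div_le_self ha hs1)
  have hαs : α t * √(t : ℝ) ≤ a := by
    calc α t * √(t : ℝ) ≤ a / √((t : ℝ) + 1) * √((t : ℝ) + 1) :=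
          mul_le_mul (hα t) hst (Real.sqrt_nonneg _) (by positivity)
      _ = a := div_mul_cancel₀ _ hs0.ne'
  calc α t * ‖gradient F (x t ω)‖
      ≤ α t * (‖gradient F x₁‖ + 2 * (L * R) * a * √(t : ℝ)) :=
        mul_le_mul_of_nonneg_left hgrow (hα0 t)
    _ = α t * ‖gradient F x₁‖ + 2 * (L * R) * (a * (α t * √(t : ℝ))) := by ring
    _ ≤ a * ‖gradient F x₁‖ + 2 * (L * R) * 1 := by
        have h : a * (α t * √(t : ℝ)) ≤ 1 := by nlinarith
        gcongr
    _ = _ := by ring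

end Recursion

/-! ### Drift and exponential moment of a single step -/

section Step

variable {d : ℕ} {p σ R γ₁ γ₂ : ℝ} {K : ℝ≥0} {P : EuclideanSpace ℝ (Fin d) → ℝ}
  {Ψ : EuclideanSpace ℝ (Fin d) → EuclideanSpace ℝ (Fin d)}

/-- The symmetrized mini-batch noise `z₁ - z₂ + (z₃ + ⋯ + z_{B + 2}) / B`. -/
noncomputable def batchNoise {E : Type*} [NormedAddCommGroup E] [NormedSpace ℝ E] (B : ℕ)
    (z : ℕ → E) : E :=
  z 1 - z 2 + (1 / (B : ℝ)) • ∑ j ∈ Finset.Icc 1 B, z (j + 2)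

theorem batchNoise_congr {E : Type*} [NormedAddCommGroup E] [NormedSpace ℝ E] {B : ℕ}
    {z z' : ℕ → E} (h : ∀ j ∈ Finset.Icc 1 (B + 2), z j = z' j) :
    batchNoise B z = batchNoise B z' := by
  rw [batchNoise, batchNoise, h 1 (by simp), h 2 (by simp)]
  rw [Finset.sum_congr rfl fun j hj => h (j + 2) (by
    rw [Finset.mem_Icc] at hj ⊢; omega)]

variable {Ω : Type*} [MeasurableSpace Ω] {μ : Measure Ω}
  {Z : ℕ → Ω → EuclideanSpace ℝ (Fin d)} {B : ℕ}

theorem aemeasurable_batchNoise (hZ : ∀ j ∈ Finset.Icc 1 (B + 2), AEMeasurable (Z j) μ) :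
    AEMeasurable (fun ω => batchNoise B fun j => Z j ω) μ := by
  have h : AEMeasurable (fun ω => ∑ j ∈ Finset.Icc 1 B, Z (j + 2) ω) μ :=
    Finset.aemeasurable_fun_sum _ fun j hj => hZ (j + 2) (by
      rw [Finset.mem_Icc] at hj ⊢; omega)
  exact ((hZ 1 (by simp)).sub (hZ 2 (by simp))).add (h.const_smul (1 / (B : ℝ)))

/-- The expected nonlinear step is aligned with the gradient up to the error of the batch mean. -/
theorem inner_integral_batchNoise_ge [IsProbabilityMeasure μ] (hΨ : IsMonotoneClipping R K Ψ)
    (hP : IsNoiseDensity p σ P) (hp1 : 1 < p) (hp2 : p ≤ 2) (hσ : 0 < σ)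
    (hγ : AreAlignmentConstants Ψ P γ₁ γ₂)
    (hlaw : ∀ j ∈ Finset.Icc 1 (B + 2), HasLaw (Z j) (noiseLaw P) μ)
    (hind : iIndepFun (fun j : Finset.Icc 1 (B + 2) => Z j) μ)
    {r : ℝ} (hr : 0 < r) (hrB : r ^ p ≤ (B : ℝ)) (v : EuclideanSpace ℝ (Fin d)) :
    min (γ₁ * ‖v‖) (γ₂ * ‖v‖ ^ 2) - ‖v‖ * (K * (3 * σ * r ^ (1 - p)))
      ≤ ∫ ω, inner ℝ v (Ψ (v + batchNoise B fun j => Z j ω)) ∂μ := by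
  have := hP.isProbabilityMeasure
  have hZm : ∀ j ∈ Finset.Icc 1 (B + 2), AEMeasurable (Z j) μ := fun j hj =>
    (hlaw j hj).aemeasurable
  have h1 : 1 ∈ Finset.Icc 1 (B + 2) := by simp
  have h2 : 2 ∈ Finset.Icc 1 (B + 2) := by simp
  have hpair : ∀ i ∈ Finset.Icc 1 (B + 2), ∀ j ∈ Finset.Icc 1 (B + 2), i ≠ j →
      IndepFun (Z i) (Z j) μ := fun i hi j hj hij =>
    hind.indepFun (i := ⟨i, hi⟩) (j := ⟨j, hj⟩) fun h => hij (congrArg Subtype.val h)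
  have hshift : ∀ j ∈ Finset.Icc 1 B, j + 2 ∈ Finset.Icc 1 (B + 2) := fun j hj => by
    rw [Finset.mem_Icc] at hj ⊢; omega
  set S : Ω → EuclideanSpace ℝ (Fin d) := fun ω =>
    (1 / (B : ℝ)) • ∑ j ∈ Finset.Icc 1 B, Z (j + 2) ω with hS
  have hmean : ∫ ω, ‖S ω‖ ∂μ ≤ 3 * σ * r ^ (1 - p) := by
    have h := integral_norm_batch_mean_le (Z := fun j => Z (j + 2)) (s := Finset.Icc 1 B) hp1 hp2 hσ
      hP.moment hP.mean (fun j hj => hlaw _ (hshift j hj))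
      (fun i hi j hj hij => hpair _ (hshift i hi) _ (hshift j hj) (by omega)) hr
      (by simpa using hrB)
    simpa [hS] using h
  have hid := integrable_id_of_lintegral_norm_rpow_le hp1 hP.moment
  have hZi : ∀ j ∈ Finset.Icc 1 (B + 2), Integrable (Z j) μ := fun j hj => by
    have h := hid
    rw [← (hlaw j hj).map_eq] at h
    exact h.comp_aemeasurable (hZm j hj)
  have hSi : Integrable S μ := by
    have h : Integrable (fun ω => ∑ j ∈ Finset.Icc 1 B, Z (j + 2) ω) μ :=
      integrable_finsetSum _ fun j hj => hZi _ (hshift j hj)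
    exact h.smul (1 / (B : ℝ))
  have hpl : Measure.map (fun ω => (Z 1 ω, Z 2 ω)) μ = (noiseLaw P).prod (noiseLaw P) := by
    rw [(indepFun_iff_map_prod_eq_prod_map_map (hZm 1 h1) (hZm 2 h2)).1
      (hpair 1 h1 2 h2 (by omega)), (hlaw 1 h1).map_eq, (hlaw 2 h2).map_eq]
  have hΨm : Measurable Ψ := hΨ.lipschitz.continuous.measurable
  have hden : inner ℝ (denoised Ψ P v) v = ∫ ω, inner ℝ v (Ψ (v + (Z 1 ω - Z 2 ω))) ∂μ := by
    rw [hΨ.inner_denoised, ← hpl, integral_map ((hZm 1 h1).prodMk (hZm 2 h2))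
      (Measurable.aestronglyMeasurable (by fun_prop))]
    simp_rw [real_inner_comm v]
  have hwi : Integrable (fun ω => inner ℝ v (Ψ (v + (Z 1 ω - Z 2 ω)))) μ :=
    (hΨ.integrable_comp (((hZm 1 h1).sub (hZm 2 h2)).const_add v)).const_inner v
  have hWi : Integrable (fun ω => inner ℝ v (Ψ (v + batchNoise B fun j => Z j ω))) μ :=
    (hΨ.integrable_comp ((aemeasurable_batchNoise hZm).const_add v)).const_inner v
  -- Removing the batch mean `S` from the argument of `Ψ` costs at most `K * ‖S‖`; what remains
  -- integrates to the denoised map. No independence of `S` from the first two noises is used.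
  have hcmp : ∫ ω, (inner ℝ v (Ψ (v + (Z 1 ω - Z 2 ω))) - ‖v‖ * K * ‖S ω‖) ∂μ
      ≤ ∫ ω, inner ℝ v (Ψ (v + batchNoise B fun j => Z j ω)) ∂μ := by
    refine integral_mono (hwi.sub (hSi.norm.const_mul _)) hWi fun ω => ?_
    have hl := hΨ.lipschitz.dist_le_mul (v + (Z 1 ω - Z 2 ω)) (v + batchNoise B fun j => Z j ω)
    have he : v + (Z 1 ω - Z 2 ω) - (v + batchNoise B fun j => Z j ω) = -S ω := by
      simp only [batchNoise, hS]; abel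
    rw [dist_eq_norm, dist_eq_norm, he, norm_neg] at hl
    have hi := (real_inner_le_norm v
      (Ψ (v + (Z 1 ω - Z 2 ω)) - Ψ (v + batchNoise B fun j => Z j ω))).trans
      (mul_le_mul_of_nonneg_left hl (norm_nonneg v))
    rw [inner_sub_right] at hi
    simp only
    linarith
  rw [integral_sub hwi (hSi.norm.const_mul _), integral_const_mul, ← hden] at hcmp
  have h3 := hγ.2.2 v
  have h4 : ‖v‖ * K * ∫ ω, ‖S ω‖ ∂μ ≤ ‖v‖ * K * (3 * σ * r ^ (1 - p)) :=
    mul_le_mul_of_nonneg_left hmean (by positivity)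
  linarith

/-- Young's inequality in each regime of the minimum: the linear one uses `α * n ≤ G`, the quadratic
one `α ≤ 1`. -/
theorem batch_error_le {γ₁ γ₂ α n G e : ℝ} (h1 : 0 < γ₁) (h2 : 0 < γ₂) (hα0 : 0 ≤ α)
    (hα1 : α ≤ 1) (hn : 0 ≤ n) (hG : α * n ≤ G) :
    α * (n * e) ≤ 1 / 4 * (α * min (γ₁ * n) (γ₂ * n ^ 2)) + (1 / γ₂ + G / γ₁) * e ^ 2 := by
  have hG0 : 0 ≤ G := (mul_nonneg hα0 hn).trans hG
  rcases min_cases (γ₁ * n) (γ₂ * n ^ 2) with ⟨h, -⟩ | ⟨h, -⟩ <;> rw [h]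
  · have hy : e ≤ 1 / 4 * γ₁ + e ^ 2 / γ₁ := by
      rw [← sub_nonneg]
      have : 1 / 4 * γ₁ + e ^ 2 / γ₁ - e = (γ₁ / 2 - e) ^ 2 / γ₁ := by field_simp; ring
      rw [this]; positivity
    have h3 := mul_le_mul_of_nonneg_left hy (mul_nonneg hα0 hn)
    have h4 : α * n * (e ^ 2 / γ₁) ≤ G * (e ^ 2 / γ₁) :=
      mul_le_mul_of_nonneg_right hG (by positivity)
    have h5 : 0 ≤ 1 / γ₂ * e ^ 2 := by positivity
    have h6 : G * (e ^ 2 / γ₁) = G / γ₁ * e ^ 2 := by ring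
    linarith
  · have hy : n * e ≤ 1 / 4 * (γ₂ * n ^ 2) + 1 / γ₂ * e ^ 2 := by
      rw [← sub_nonneg]
      have : 1 / 4 * (γ₂ * n ^ 2) + 1 / γ₂ * e ^ 2 - n * e = (γ₂ * n / 2 - e) ^ 2 / γ₂ := by
        field_simp; ring
      rw [this]; positivity
    have h3 := mul_le_mul_of_nonneg_left hy hα0
    have h4 : α * (1 / γ₂ * e ^ 2) ≤ 1 * (1 / γ₂ * e ^ 2) :=
      mul_le_mul_of_nonneg_right hα1 (by positivity)
    have h5 : 0 ≤ G / γ₁ * e ^ 2 := by positivity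
    linarith

/-- The second-order term of the exponential is absorbed by a quarter of the drift; this dictates
how small `lam` must be. -/
theorem quadratic_term_le {γ₁ γ₂ α n G R lam : ℝ} (hα0 : 0 ≤ α)
    (hα1 : α ≤ 1) (hn : 0 ≤ n) (hG : α * n ≤ G) (hlam : 0 ≤ lam)
    (hl1 : lam * (G * R ^ 2) ≤ γ₁ / 4) (hl2 : lam * R ^ 2 ≤ γ₂ / 4) :
    lam * (α * n * R) ^ 2 ≤ 1 / 4 * (α * min (γ₁ * n) (γ₂ * n ^ 2)) := by
  rcases min_cases (γ₁ * n) (γ₂ * n ^ 2) with ⟨h, -⟩ | ⟨h, -⟩ <;> rw [h]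
  · have h3 : α * n * (lam * (α * n * R ^ 2)) ≤ α * n * (lam * (G * R ^ 2)) := by gcongr
    have h4 := mul_le_mul_of_nonneg_left hl1 (mul_nonneg hα0 hn)
    linarith
  · have h3 : α * (α * n ^ 2 * (lam * R ^ 2)) ≤ α * (1 * n ^ 2 * (lam * R ^ 2)) := by gcongr
    have h4 := mul_le_mul_of_nonneg_left hl2 (mul_nonneg hα0 (sq_nonneg n))
    linarith

theorem lintegral_exp_step_le [IsProbabilityMeasure μ] (hΨ : IsMonotoneClipping R K Ψ)
    (hP : IsNoiseDensity p σ P) (hp1 : 1 < p) (hp2 : p ≤ 2) (hσ : 0 < σ)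
    (hγ : AreAlignmentConstants Ψ P γ₁ γ₂)
    (hlaw : ∀ j ∈ Finset.Icc 1 (B + 2), HasLaw (Z j) (noiseLaw P) μ)
    (hind : iIndepFun (fun j : Finset.Icc 1 (B + 2) => Z j) μ)
    {r : ℝ} (hr : 0 < r) (hrB : r ^ p ≤ (B : ℝ)) {α G lam : ℝ} (hα0 : 0 ≤ α) (hα1 : α ≤ 1)
    (hlam : 0 ≤ lam) (hl0 : lam * (G * R) ≤ 1)
    (hl1 : lam * (G * R ^ 2) ≤ γ₁ / 4) (hl2 : lam * R ^ 2 ≤ γ₂ / 4)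
    (v : EuclideanSpace ℝ (Fin d)) (hv : α * ‖v‖ ≤ G) :
    ∫⁻ ω, ENNReal.ofReal (Real.exp
        (-(lam * α * inner ℝ v (Ψ (v + batchNoise B fun j => Z j ω))))) ∂μ
      ≤ ENNReal.ofReal (Real.exp (-(lam * (1 / 2 * (α * min (γ₁ * ‖v‖) (γ₂ * ‖v‖ ^ 2))
          - (1 / γ₂ + G / γ₁) * (K * (3 * σ * r ^ (1 - p))) ^ 2)))) := by
  have hR : 0 ≤ R := (norm_nonneg _).trans (hΨ.bound 0)
  have hWm := aemeasurable_batchNoise fun j hj => (hlaw j hj).aemeasurable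
  have hΨm : Measurable Ψ := hΨ.lipschitz.continuous.measurable
  have hXm : AEMeasurable (fun ω =>
      -(lam * α * inner ℝ v (Ψ (v + batchNoise B fun j => Z j ω)))) μ :=
    ((hΨm.comp_aemeasurable (hWm.const_add v)).const_inner.const_mul (lam * α)).neg
  have hc1 : lam * (α * ‖v‖ * R) ≤ 1 := by
    refine le_trans ?_ hl0
    gcongr
  refine (lintegral_exp_le hXm hc1 fun ω => ?_).trans
    (ENNReal.ofReal_le_ofReal (Real.exp_le_exp.2 ?_))
  · rw [abs_neg, abs_mul, abs_of_nonneg (mul_nonneg hlam hα0)]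
    calc lam * α * |inner ℝ v (Ψ (v + batchNoise B fun j => Z j ω))|
        ≤ lam * α * (‖v‖ * R) := by
          gcongr
          exact (abs_real_inner_le_norm _ _).trans
            (mul_le_mul_of_nonneg_left (hΨ.bound _) (norm_nonneg v))
      _ = lam * (α * ‖v‖ * R) := by ring
  · rw [integral_neg, integral_const_mul]
    have h1 := mul_le_mul_of_nonneg_left (inner_integral_batchNoise_ge hΨ hP hp1 hp2 hσ hγ hlaw hind hr
      hrB v) (mul_nonneg hlam hα0)
    have h2 := mul_le_mul_of_nonneg_left (batch_error_le (e := K * (3 * σ * r ^ (1 - p)))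
      hγ.1 hγ.2.1 hα0 hα1 (norm_nonneg v) hv) hlam
    have h3 := mul_le_mul_of_nonneg_left (quadratic_term_le (γ₁ := γ₁) (γ₂ := γ₂)
      hα0 hα1 (norm_nonneg v) hv hlam hl1 hl2) hlam
    linarith

end Step

/-! ### Step sizes, batch sizes and elementary sums -/

theorem IsSmoothNonlinearity.bound_nonneg {d : ℕ} {C : ℝ}
    {Ψ : EuclideanSpace ℝ (Fin d) → EuclideanSpace ℝ (Fin d)} (h : IsSmoothNonlinearity C Ψ) :
    0 ≤ C := by
  rcases h with ⟨ψ, -, -, -, -, -, h6, -⟩ | ⟨φ, -, -, -, -, -, h6, -⟩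
  · exact (abs_nonneg _).trans (h6 0)
  · exact (norm_nonneg _).trans (h6 0)

theorem stepSize_nonneg {a : ℝ} (ha : 0 ≤ a) (η : ℝ) (t : ℕ) : 0 ≤ stepSize a η t :=
  div_nonneg ha (Real.rpow_nonneg (by positivity) _)

theorem stepSize_le_div_sqrt {a η : ℝ} (ha : 0 ≤ a) (hη : 1 / 2 ≤ η) (t : ℕ) :
    stepSize a η t ≤ a / √(t + 1 : ℝ) := by
  have h1 : (1 : ℝ) ≤ t + 1 := by linarith [(Nat.cast_nonneg t : (0 : ℝ) ≤ t)]
  rw [stepSize, Real.sqrt_eq_rpow]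
  exact div_le_div_of_nonneg_left ha (by positivity) (Real.rpow_le_rpow_of_exponent_le h1 hη)

theorem stepSize_le {a η : ℝ} (ha : 0 ≤ a) (hη : 0 ≤ η) (t : ℕ) : stepSize a η t ≤ a := by
  have h1 : (1 : ℝ) ≤ t + 1 := by linarith [(Nat.cast_nonneg t : (0 : ℝ) ≤ t)]
  exact div_le_self ha (Real.one_le_rpow h1 hη)

theorem stepSize_sq (a η : ℝ) (t : ℕ) :
    stepSize a η t ^ 2 = a ^ 2 * ((t : ℝ) + 1) ^ (-2 * η) := by
  have h0 : (0 : ℝ) ≤ t + 1 := by positivity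
  rw [stepSize, div_pow, ← Real.rpow_natCast (((t : ℝ) + 1) ^ η), ← Real.rpow_mul h0,
    div_eq_mul_inv, ← Real.rpow_neg h0]
  congr 2
  push_cast
  ring

theorem div_two_mul_rpow_le_stepSize {a η : ℝ} (ha : 0 ≤ a) (hη0 : 0 ≤ η) (hη1 : η ≤ 1) {k t : ℕ}
    (hkt : k ≤ t) (ht : 1 ≤ t) : a / 2 * (t : ℝ) ^ (-η) ≤ stepSize a η k := by
  have ht' : (1 : ℝ) ≤ t := by exact_mod_cast ht
  have hk : (k : ℝ) ≤ t := by exact_mod_cast hkt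
  have h1 : ((k : ℝ) + 1) ^ η ≤ 2 * (t : ℝ) ^ η := by
    calc ((k : ℝ) + 1) ^ η ≤ (2 * (t : ℝ)) ^ η :=
          Real.rpow_le_rpow (by positivity) (by linarith) hη0
      _ = 2 ^ η * (t : ℝ) ^ η := Real.mul_rpow (by norm_num) (by positivity)
      _ ≤ 2 * (t : ℝ) ^ η := by
          gcongr
          calc (2 : ℝ) ^ η ≤ 2 ^ (1 : ℝ) := Real.rpow_le_rpow_of_exponent_le (by norm_num) hη1
            _ = 2 := Real.rpow_one 2
  rw [stepSize, Real.rpow_neg (by positivity)]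
  have h2 : 0 < ((k : ℝ) + 1) ^ η := by positivity
  have h3 : 0 < (t : ℝ) ^ η := by positivity
  calc a / 2 * ((t : ℝ) ^ η)⁻¹ = a / (2 * (t : ℝ) ^ η) := by field_simp
    _ ≤ a / ((k : ℝ) + 1) ^ η := div_le_div_of_nonneg_left ha h2 h1

theorem sum_one_div_le_one_add_log (t : ℕ) :
    ∑ k ∈ Finset.Icc 1 t, (1 : ℝ) / k ≤ 1 + Real.log t := by
  refine le_trans (le_of_eq ?_) (harmonic_le_one_add_log t)
  rw [harmonic_eq_sum_Icc]
  push_cast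
  simp only [one_div]

/-- The target bound has no additive constant and `log t` vanishes at `t = 1`; the first summand, at
least `1 / 4`, lets constants be absorbed into the sum. -/
theorem one_le_four_mul_sum_rpow {η : ℝ} (hη : η ≤ 1) {t : ℕ} (ht : 1 ≤ t) :
    1 ≤ 4 * ∑ k ∈ Finset.Icc 1 t, ((k : ℝ) + 1) ^ (-2 * η) := by
  have h1 : (((1 : ℕ) : ℝ) + 1) ^ (-2 * η) ≤ ∑ k ∈ Finset.Icc 1 t, ((k : ℝ) + 1) ^ (-2 * η) :=
    Finset.single_le_sum (f := fun k : ℕ => ((k : ℝ) + 1) ^ (-2 * η))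
      (fun k _ => by positivity) (Finset.mem_Icc.2 ⟨le_rfl, ht⟩)
  have h2 : (1 : ℝ) / 4 ≤ (((1 : ℕ) : ℝ) + 1) ^ (-2 * η) := by
    calc (1 : ℝ) / 4 = 2 ^ (-2 : ℝ) := by
          rw [Real.rpow_neg (by norm_num), Real.rpow_two]; norm_num
      _ ≤ 2 ^ (-2 * η) := Real.rpow_le_rpow_of_exponent_le (by norm_num) (by linarith)
      _ = _ := by norm_num
  have h3 := h2.trans h1
  linarith

theorem rpow_le_batchSize (p : ℝ) (t : ℕ) :
    ((t : ℝ) ^ (1 / (2 * (p - 1)))) ^ p ≤ (batchSize p t : ℝ) := by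
  rw [← Real.rpow_mul (Nat.cast_nonneg t), batchSize]
  refine le_trans (le_of_eq ?_) (Nat.le_ceil _)
  congr 1
  ring

/-- The batch exponent is chosen so that `r ^ (2 * (1 - p)) = 1 / t` for `r = t ^ (1 / (2 * (p -
1)))`. -/
theorem batch_error_sq {p : ℝ} (hp1 : 1 < p) {t : ℕ} (ht : 1 ≤ t) (K σ : ℝ) :
    (K * (3 * σ * ((t : ℝ) ^ (1 / (2 * (p - 1)))) ^ (1 - p))) ^ 2
      = (K * (3 * σ)) ^ 2 * (1 / t) := by
  have ht0 : (0 : ℝ) < t := by exact_mod_cast ht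
  have hp0 : p - 1 ≠ 0 := by linarith
  rw [← Real.rpow_mul ht0.le, ← mul_assoc, mul_pow _ (_ ^ _) 2, ← Real.rpow_natCast (_ ^ _) 2,
    ← Real.rpow_mul ht0.le]
  have : 1 / (2 * (p - 1)) * (1 - p) * ((2 : ℕ) : ℝ) = -1 := by
    push_cast; field_simp; ring
  rw [this, Real.rpow_neg_one, one_div]

/-- A bound on a weighted sum of `min (γ₁ n) (γ₂ n²)` yields one on the average of `min n n²`. -/
theorem average_min_le {γ₁ γ₂ a η Q S : ℝ} (h1 : 0 < γ₁) (h2 : 0 < γ₂) (ha : 0 < a)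
    (hη0 : 0 ≤ η) (hη1 : η ≤ 1) {t : ℕ} (ht : 1 ≤ t) {n : ℕ → ℝ} (hn : ∀ k, 0 ≤ n k)
    (h : ∑ k ∈ Finset.Icc 1 t, 1 / 2 * (stepSize a η k * min (γ₁ * n k) (γ₂ * n k ^ 2)) ≤ Q * S) :
    1 / (t : ℝ) * ∑ k ∈ Finset.Icc 1 t, min (n k) (n k ^ 2)
      ≤ 4 * Q / (min γ₁ γ₂ * a) * ((t : ℝ) ^ (η - 1) * S) := by
  have ht0 : (0 : ℝ) < t := by exact_mod_cast ht
  have hγ : 0 < min γ₁ γ₂ := lt_min h1 h2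
  have hle : min γ₁ γ₂ * a / 4 * (t : ℝ) ^ (-η) * ∑ k ∈ Finset.Icc 1 t, min (n k) (n k ^ 2)
      ≤ Q * S := by
    refine le_trans ?_ h
    rw [Finset.mul_sum]
    refine Finset.sum_le_sum fun k hk => ?_
    have hm : min γ₁ γ₂ * min (n k) (n k ^ 2) ≤ min (γ₁ * n k) (γ₂ * n k ^ 2) :=
      le_min
        (mul_le_mul (min_le_left _ _) (min_le_left _ _) (le_min (hn k) (sq_nonneg _)) h1.le)
        (mul_le_mul (min_le_right _ _) (min_le_right _ _) (le_min (hn k) (sq_nonneg _)) h2.le)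
    have hs := div_two_mul_rpow_le_stepSize ha.le hη0 hη1 (Finset.mem_Icc.1 hk).2 ht
    have h0 : 0 ≤ min γ₁ γ₂ * min (n k) (n k ^ 2) :=
      mul_nonneg hγ.le (le_min (hn k) (sq_nonneg _))
    have := mul_le_mul hs hm h0 (stepSize_nonneg ha.le η k)
    linarith
  have hr : (t : ℝ) ^ (-η) = ((t : ℝ) * (t : ℝ) ^ (η - 1))⁻¹ := by
    rw [Real.rpow_sub_one ht0.ne', mul_div_cancel₀ _ ht0.ne', Real.rpow_neg ht0.le]
  have hT : 0 < (t : ℝ) ^ (η - 1) := by positivity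
  rw [hr] at hle
  set T := ∑ k ∈ Finset.Icc 1 t, min (n k) (n k ^ 2)
  calc 1 / (t : ℝ) * T
      = 4 / (min γ₁ γ₂ * a) * (t : ℝ) ^ (η - 1)
        * (min γ₁ γ₂ * a / 4 * ((t : ℝ) * (t : ℝ) ^ (η - 1))⁻¹ * T) := by field_simp
    _ ≤ 4 / (min γ₁ γ₂ * a) * (t : ℝ) ^ (η - 1) * (Q * S) :=
        mul_le_mul_of_nonneg_left hle (by positivity)
    _ = _ := by ring

/-! ### From the exponential moment to the high-probability bound -/

/-- If `E[e ^ X] ≤ 1`, then `X < log (1 / δ)` with probability at least `1 - δ`. -/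
theorem one_sub_le_measureReal_of_lintegral_exp_le_one {Ω : Type*} [MeasurableSpace Ω]
    {μ : Measure Ω} [IsProbabilityMeasure μ] {X : Ω → ℝ}
    (hX : ∫⁻ ω, ENNReal.ofReal (Real.exp (X ω)) ∂μ ≤ 1) (hXm : AEMeasurable X μ) {δ : ℝ}
    (hδ : 0 < δ) {s : Set Ω} (hs : ∀ ω, X ω < Real.log (1 / δ) → ω ∈ s) : 1 - δ ≤ μ.real s := by
  have hm := mul_meas_ge_le_lintegral₀
    (Real.measurable_exp.comp_aemeasurable hXm).ennreal_ofReal (ENNReal.ofReal (1 / δ))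
  have hsub : sᶜ ⊆ {ω | ENNReal.ofReal (1 / δ) ≤ ENNReal.ofReal ((Real.exp ∘ X) ω)} := by
    intro ω hω
    have h1 : Real.log (1 / δ) ≤ X ω := not_lt.1 fun h => hω (hs ω h)
    have h2 : 1 / δ ≤ Real.exp (X ω) := by
      rw [← Real.exp_log (one_div_pos.2 hδ)]; exact Real.exp_le_exp.2 h1
    exact ENNReal.ofReal_le_ofReal h2
  have hc : μ sᶜ ≤ ENNReal.ofReal δ := by
    have h1 : ENNReal.ofReal (1 / δ) * μ sᶜ ≤ 1 :=
      (mul_le_mul_right (measure_mono hsub) _).trans (hm.trans hX)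
    calc μ sᶜ = ENNReal.ofReal δ * (ENNReal.ofReal (1 / δ) * μ sᶜ) := by
          rw [← mul_assoc, ← ENNReal.ofReal_mul hδ.le, mul_one_div_cancel hδ.ne',
            ENNReal.ofReal_one, one_mul]
      _ ≤ ENNReal.ofReal δ * 1 := mul_le_mul_right h1 _
      _ = ENNReal.ofReal δ := mul_one _
  -- Subadditivity suffices, so `s` need not be measurable.
  have hu : (1 : ℝ) ≤ μ.real s + μ.real sᶜ := by
    have := measureReal_union_le (μ := μ) s sᶜ
    rwa [Set.union_compl_self, probReal_univ] at this
  have hc' : μ.real sᶜ ≤ δ := ENNReal.toReal_le_of_le_ofReal hδ.le hc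
  linarith

theorem msge_eq_gradient_add_batchNoise {d : ℕ} {Ω Ξ : Type*} [MeasurableSpace Ξ] (ν : Measure Ξ)
    (f : EuclideanSpace ℝ (Fin d) → Ξ → ℝ) (y : EuclideanSpace ℝ (Fin d))
    (ξ : ℕ → ℕ → Ω → Ξ) (x : ℕ → Ω → EuclideanSpace ℝ (Fin d)) {B : ℕ} (hB : 0 < B) (t : ℕ)
    (ω : Ω) :
    msge f y B (x t ω) (fun j => ξ t j ω)
      = gradient (populationCost ν f) (x t ω)
        + batchNoise B fun j => gradNoise ν f y ξ x t j ω := by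
  have hB' : (B : ℝ) ≠ 0 := by exact_mod_cast hB.ne'
  have hsum : ∑ j ∈ Finset.Icc 1 B, gradNoise ν f y ξ x t (j + 2) ω
      = ∑ j ∈ Finset.Icc 1 B, stochGrad f y (ξ t (j + 2) ω)
        - (B : ℝ) • gradient (populationCost ν f) y := by
    have : ∀ j ∈ Finset.Icc 1 B, gradNoise ν f y ξ x t (j + 2) ω
        = stochGrad f y (ξ t (j + 2) ω) - gradient (populationCost ν f) y := fun j _ => by
      rw [gradNoise, if_neg (by omega)]
    rw [Finset.sum_congr rfl this, Finset.sum_sub_distrib, Finset.sum_const, Nat.card_Icc,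
      Nat.add_sub_cancel, Nat.cast_smul_eq_nsmul]
  rw [batchNoise, hsum, smul_sub, smul_smul, one_div_mul_cancel hB', one_smul, msge]
  simp only [gradNoise, if_true, if_neg (show (2 : ℕ) ≠ 1 by decide)]
  abel

theorem batchSize_pos {p : ℝ} {t : ℕ} (ht : 1 ≤ t) : 0 < batchSize p t :=
  Nat.ceil_pos.2 (Real.rpow_pos_of_pos (by exact_mod_cast ht) _)

theorem IsIIDNoise.indepFun_batchNoise {d : ℕ} {Ω : Type*} [MeasurableSpace Ω] {μ : Measure Ω}
    {P : EuclideanSpace ℝ (Fin d) → ℝ} {B : ℕ → ℕ}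
    {x : ℕ → Ω → EuclideanSpace ℝ (Fin d)} {z : ℕ → ℕ → Ω → EuclideanSpace ℝ (Fin d)}
    (h : IsIIDNoise μ P B x z) {t : ℕ} (ht : 1 ≤ t) :
    IndepFun (fun ω (k : Finset.Icc 1 t) => x k ω)
      (fun ω => batchNoise (B t) fun j => z t j ω) μ := by
  have hg : Measurable fun ζ : Finset.Icc 1 (B t + 2) → EuclideanSpace ℝ (Fin d) =>
      batchNoise (B t) (extendZero _ ζ) := by
    have hem := measurable_extendZero (E := EuclideanSpace ℝ (Fin d)) (Finset.Icc 1 (B t + 2))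
    exact ((hem 1).sub (hem 2)).add
      ((Finset.measurable_fun_sum _ fun j _ => hem (j + 2)).const_smul (1 / (B t : ℝ)))
  have hz : (fun ω => batchNoise (B t) fun j => z t j ω)
      = (fun ζ : Finset.Icc 1 (B t + 2) → EuclideanSpace ℝ (Fin d) =>
          batchNoise (B t) (extendZero _ ζ)) ∘ fun ω j => z t j ω :=
    funext fun ω => batchNoise_congr fun j hj => (extendZero_of_mem hj fun j => z t j ω).symm
  rw [hz]
  exact (h t ht).2.2.comp measurable_id hg

theorem theorem3 {d : ℕ}
    (C : ℝ) (Ψ : EuclideanSpace ℝ (Fin d) → EuclideanSpace ℝ (Fin d))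
    (hΨ : IsSmoothNonlinearity C Ψ)
    (p σ : ℝ) (hp1 : 1 < p) (hp2 : p ≤ 2) (hσ : 0 < σ)
    (P : EuclideanSpace ℝ (Fin d) → ℝ) (hP : IsNoiseDensity p σ P) :
    (∃ γ₁ γ₂ : ℝ, AreAlignmentConstants Ψ P γ₁ γ₂) ∧
    ∀ γ₁ γ₂ : ℝ, AreAlignmentConstants Ψ P γ₁ γ₂ →
    ∀ (L : ℝ≥0) (Δ η a : ℝ), 1 / 2 ≤ η → η < 1 → 0 < a → a ≤ 1 →
      a ≤ γ₂ / (1 + 8 * C ^ 2) →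
    ∃ M : ℝ,
      ∀ (Ω : Type*) [MeasurableSpace Ω] (μ : Measure Ω) [IsProbabilityMeasure μ]
        (Ξ : Type*) [MeasurableSpace Ξ] (ν : Measure Ξ) [IsProbabilityMeasure ν]
        (f : EuclideanSpace ℝ (Fin d) → Ξ → ℝ)
        (x₁ y : EuclideanSpace ℝ (Fin d))
        (ξ : ℕ → ℕ → Ω → Ξ) (x : ℕ → Ω → EuclideanSpace ℝ (Fin d)),
        (∀ u, Integrable (f u) ν) →
        (∀ s, Differentiable ℝ (fun u => f u s)) →
        Differentiable ℝ (populationCost ν f) →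
        LipschitzWith L (gradient (populationCost ν f)) →
        BddBelow (Set.range (populationCost ν f)) →
        populationCost ν f x₁ - (⨅ u, populationCost ν f u) ≤ Δ →
        -- the last bound on `a`, cleared of its denominator, which may vanish
        a * ((1 + 8 * C ^ 2) * (L * C + (1 - η) * ‖gradient (populationCost ν f) x₁‖))
          ≤ (1 - η) * γ₁ →
        (∀ t j, HasLaw (ξ t j) ν μ) →
        IsNMSGE Ψ f a η p x₁ y ξ x →
        IsIIDNoise μ P (batchSize p) x (gradNoise ν f y ξ x) →
        ∀ t : ℕ, 1 ≤ t → ∀ δ : ℝ, 0 < δ → δ < 1 →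
          1 - δ ≤ μ.real {ω |
            (1 / (t : ℝ)) * ∑ k ∈ Finset.Icc 1 t,
                min ‖gradient (populationCost ν f) (x k ω)‖
                  (‖gradient (populationCost ν f) (x k ω)‖ ^ 2)
              ≤ M * ((t : ℝ) ^ (η - 1) *
                  (Real.log (1 / δ) + Real.log t
                    + ∑ k ∈ Finset.Icc 1 t, ((k : ℝ) + 1) ^ (-2 * η)))} := by
  obtain ⟨R, K, hΨ'⟩ := hΨ.isMonotoneClipping
  refine ⟨hΨ'.exists_alignmentConstants hP, ?_⟩
  intro γ₁ γ₂ hγ L Δ η a hη hη1 ha ha1 _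
  have hC := hΨ.bound_nonneg
  have hR : 0 ≤ R := (norm_nonneg _).trans (hΨ'.bound 0)
  have hγ₁ := hγ.1
  have hγ₂ := hγ.2.1
  set G : ℝ := γ₁ + 2 * (L * R) with hGdef
  have hG : 0 < G := by positivity
  obtain ⟨lam, hlam, hl0, hl1, hl2⟩ : ∃ lam : ℝ, 0 < lam ∧ lam * (G * R) ≤ 1 ∧
      lam * (G * R ^ 2) ≤ γ₁ / 4 ∧ lam * R ^ 2 ≤ γ₂ / 4 := by
    set D := 1 + G * R + 4 * (G * R ^ 2) / γ₁ + 4 * R ^ 2 / γ₂ with hD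
    have hA : 0 ≤ G * R := by positivity
    have hB : 0 ≤ 4 * (G * R ^ 2) / γ₁ := by positivity
    have hE : 0 ≤ 4 * R ^ 2 / γ₂ := by positivity
    have hD0 : 0 < D := by positivity
    refine ⟨D⁻¹, inv_pos.2 hD0, ?_, ?_, ?_⟩
    · rw [inv_mul_le_iff₀ hD0]; linarith
    · rw [inv_mul_le_iff₀ hD0]
      calc G * R ^ 2 = (4 * (G * R ^ 2) / γ₁) * (γ₁ / 4) := by field_simp
        _ ≤ D * (γ₁ / 4) := mul_le_mul_of_nonneg_right (by linarith) (by positivity)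
    · rw [inv_mul_le_iff₀ hD0]
      calc R ^ 2 = (4 * R ^ 2 / γ₂) * (γ₂ / 4) := by field_simp
        _ ≤ D * (γ₂ / 4) := mul_le_mul_of_nonneg_right (by linarith) (by positivity)
  set c : ℝ := (1 / γ₂ + G / γ₁) * (K * (3 * σ)) ^ 2 with hc
  have hc0 : 0 ≤ c := by positivity
  set q : ℝ := L * R ^ 2 * a ^ 2 with hq
  have hq0 : 0 ≤ q := by positivity
  -- `1 / lam` pays for `log (1 / δ)`, `c` for the harmonic sum and `q` for the squared steps; the
  -- factors 4 absorb the constants `Δ` and `c` into the sum. The absolute value keeps `Q`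
  -- nonnegative whatever the sign of `Δ`.
  set Q : ℝ := 1 / lam + 4 * |Δ| + 4 * c + q with hQ
  refine ⟨4 * Q / (min γ₁ γ₂ * a), ?_⟩
  intro Ω _ μ _ Ξ _ ν _ f x₁ y ξ x _ _ hFd hFL hFb hΔ haG _ hx hnoise t ht δ hδ hδ1
  set F := populationCost ν f with hF
  set W : ℕ → Ω → EuclideanSpace ℝ (Fin d) := fun t ω =>
    batchNoise (batchSize p t) fun j => gradNoise ν f y ξ x t j ω with hW
  have hxrec : ∀ t, 1 ≤ t → ∀ ω,
      x (t + 1) ω = x t ω - stepSize a η t • Ψ (gradient F (x t ω) + W t ω) := fun t ht ω => by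
    rw [hx.2 t ht ω, msge_eq_gradient_add_batchNoise ν f y ξ x (batchSize_pos ht) t ω]
  have hWm : ∀ t, 1 ≤ t → AEMeasurable (W t) μ := fun t ht =>
    aemeasurable_batchNoise fun j hj => ((hnoise t ht).1 j hj).aemeasurable
  have hgrad : a * ‖gradient F x₁‖ ≤ γ₁ := by
    -- Discard `L * C ≥ 0` and the factor `1 + 8 * C ^ 2 ≥ 1`; then `1 - η > 0` cancels.
    have h1 : (1 - η) * (a * ‖gradient F x₁‖)
        ≤ a * ((1 + 8 * C ^ 2) * (L * C + (1 - η) * ‖gradient F x₁‖)) := by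
      have h3 : 0 ≤ (1 - η) * ‖gradient F x₁‖ := mul_nonneg (by linarith) (norm_nonneg _)
      have h4 : (0 : ℝ) ≤ L * C := by positivity
      have h5 : (1 - η) * ‖gradient F x₁‖
          ≤ (1 + 8 * C ^ 2) * (L * C + (1 - η) * ‖gradient F x₁‖) := by
        nlinarith [mul_nonneg (sq_nonneg C) (add_nonneg h4 h3)]
      have := mul_le_mul_of_nonneg_left h5 ha.le
      linarith
    exact le_of_mul_le_mul_left (h1.trans haG) (by linarith)
  have hstep : ∀ t, 1 ≤ t → ∀ ω, stepSize a η t * ‖gradient F (x t ω)‖ ≤ G := fun t ht ω =>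
    (step_norm_gradient_le hΨ' hFL hx.1 hxrec (fun t => stepSize_nonneg ha.le η t)
      (fun t => stepSize_le_div_sqrt ha.le hη t) ha.le ha1 t ht ω).trans (by linarith)
  set D : ℕ → EuclideanSpace ℝ (Fin d) → ℝ := fun k v =>
    1 / 2 * (stepSize a η k * min (γ₁ * ‖v‖) (γ₂ * ‖v‖ ^ 2)) - c * (1 / k) with hD
  have hDm : ∀ k, Measurable (D k) := fun k => by fun_prop
  have hmgf : ∀ t, 1 ≤ t → ∀ v, stepSize a η t * ‖v‖ ≤ G →
      ∫⁻ ω, ENNReal.ofReal (Real.exp (-(lam * stepSize a η t * inner ℝ v (Ψ (v + W t ω))))) ∂μ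
        ≤ ENNReal.ofReal (Real.exp (-(lam * D t v))) := fun t ht v hv => by
    have h := lintegral_exp_step_le hΨ' hP hp1 hp2 hσ hγ (hnoise t ht).1 (hnoise t ht).2.1
      (Real.rpow_pos_of_pos (by exact_mod_cast ht) _) (rpow_le_batchSize p t)
      (stepSize_nonneg ha.le η t) ((stepSize_le ha.le (by linarith) t).trans ha1)
      hlam.le hl0 hl1 hl2 v hv
    rw [batch_error_sq hp1 ht, ← mul_assoc (1 / γ₂ + G / γ₁)] at h
    exact h
  have hmain := lintegral_exp_compensated_cost_le_one hΨ' hFd hFL hx.1 hxrec hWm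
    (fun t ht => hnoise.indepFun_batchNoise ht) hlam.le hDm hstep hmgf t
  have hxm := aemeasurable_iterate hΨ'.lipschitz.continuous.measurable
    hFL.continuous.measurable hx.1 hxrec hWm
  refine one_sub_le_measureReal_of_lintegral_exp_le_one hmain ?_ hδ fun ω hω => ?_
  · refine AEMeasurable.const_mul (((hFd.continuous.measurable.comp_aemeasurable
      (hxm (t + 1) (by omega))).sub_const _).add ?_) lam
    exact Finset.aemeasurable_fun_sum _ fun k hk => ((hDm k).comp_aemeasurable
      (hFL.continuous.measurable.comp_aemeasurable (hxm k (Finset.mem_Icc.1 hk).1))).sub_const _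
  · refine average_min_le hγ₁ hγ₂ ha (by linarith) hη1.le ht
      (n := fun k => ‖gradient F (x k ω)‖) (fun k => norm_nonneg _) ?_
    have hinf : (⨅ u, F u) ≤ F (x (t + 1) ω) := ciInf_le hFb _
    have hlt : F (x (t + 1) ω) - F x₁
        + ∑ k ∈ Finset.Icc 1 t, (D k (gradient F (x k ω)) - L * (stepSize a η k * R) ^ 2)
        ≤ 1 / lam * Real.log (1 / δ) := by
      rw [div_mul_eq_mul_div, one_mul, le_div_iff₀ hlam]
      linarith
    have hsum : ∑ k ∈ Finset.Icc 1 t, (D k (gradient F (x k ω)) - L * (stepSize a η k * R) ^ 2)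
        = ∑ k ∈ Finset.Icc 1 t, 1 / 2 * (stepSize a η k *
            min (γ₁ * ‖gradient F (x k ω)‖) (γ₂ * ‖gradient F (x k ω)‖ ^ 2))
          - c * ∑ k ∈ Finset.Icc 1 t, (1 : ℝ) / k
          - q * ∑ k ∈ Finset.Icc 1 t, ((k : ℝ) + 1) ^ (-2 * η) := by
      rw [Finset.sum_sub_distrib, Finset.sum_sub_distrib, ← Finset.mul_sum _ _ c,
        Finset.mul_sum _ _ q]
      congr 1
      refine Finset.sum_congr rfl fun k _ => ?_
      rw [mul_pow, stepSize_sq, hq]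
      ring
    rw [hsum] at hlt
    have hharm := mul_le_mul_of_nonneg_left (sum_one_div_le_one_add_log t) hc0
    have hone := one_le_four_mul_sum_rpow hη1.le ht
    set S := ∑ k ∈ Finset.Icc 1 t, ((k : ℝ) + 1) ^ (-2 * η)
    have hlog : 0 ≤ Real.log t := Real.log_natCast_nonneg t
    have hlogδ : 0 ≤ Real.log (1 / δ) := Real.log_nonneg (one_le_one_div hδ hδ1.le)
    have hS : 0 ≤ S := by linarith
    have hl : 0 ≤ 1 / lam := by positivity
    have hΔ' : Δ ≤ |Δ| * (4 * S) :=
      (le_abs_self Δ).trans (le_mul_of_one_le_right (abs_nonneg Δ) hone)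
    have hc' := mul_le_mul_of_nonneg_left hone hc0
    have e1 : 0 ≤ (4 * |Δ| + 4 * c + q) * Real.log (1 / δ) := by positivity
    have e2 : 0 ≤ (1 / lam + 4 * |Δ| + 3 * c + q) * Real.log t := by positivity
    have e3 : 0 ≤ 1 / lam * S := by positivity
    simp only [hQ]
    linarith
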